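/- Let $G$ be a (finite-dimensional, real, second countable) Lie group with Lie algebra $\mathfrak g=T_1G$, whose bracket $[\cdot,\cdot]_{\mathfrak g}$ is the usual one (the commutator of left-invariant vector fields). Let $G$ act smoothly and transitively from the left on a smooth manifold $M$, let $o\in M$ and let $H=\{h\in G : h\cdot o=o\}$, so that $M=G/H$. A post-Lie algebra over a field is a vector space $A$ with a Lie bracket $[\cdot,\cdot]$ and a bilinear product $\rhd$ such that, for all $x,y,z\in A$, $$x\rhd[y,z]=[x\rhd y,z]+[y,x\rhd z],\qquad [x,y]\rhd z=a(x,y,z)-a(y,x,z),$$ where $a(x,y,z)=x\rhd(y\rhd z)-(x\rhd y)\rhd z$. For smooth maps $x,y\colon G\to\mathfrak g$ put $[x,y](g)=[x(g),y(g)]_{\mathfrak g}$ and let $x\,\tilde\rhd\,y$ be the derivative of $y$ along the vector field $\rho_*(x)(g)=\frac{\partial}{\partial t}\big|_{t=0}\,g\exp(t\,x(g))=TL_g\,x(g)$ on $G$. Let $$\Omega^0_H(G,\mathfrak g)=\{x\colon G\to\mathfrak g\ \text{smooth} : x(gh)=\mathrm{Ad}_{h^{-1}}x(g)\ \text{for all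 } g\in G,\ h\in H\}.$$ Then $\Omega^0_H(G,\mathfrak g)$ is closed under $[\cdot,\cdot]$ and $\tilde\rhd$, and $\{\Omega^0_H(G,\mathfrak g),[\cdot,\cdot],\tilde\rhd\}$ is a post-Lie algebra over $\mathbb R$. Moreover, let $G\times_H\mathfrak g\to M$, $[(g,v)]\mapsto g\cdot o$, be the Atiyah bundle, where $G\times_H\mathfrak g$ is the quotient of $G\times\mathfrak g$ by $(g,v)\sim(gh,\mathrm{Ad}_{h^{-1}}v)$, $h\in H$, with its fibrewise vector space structure, and let $\Gamma(G\times_H\mathfrak g)$ be its space of smooth sections, that is, those sections $X$ such that for every smooth local section $\sigma\colon U\to G$ of $g\mapsto g\cdot o$ over an open set $U\subseteq M$ one has $X(u)=[(\sigma(u),f(u))]$ on $U$ with $f\colon U\to\mathfrak g$ smooth. There is a linear isomorphism $\Phi\colon\Omega^0_H(G,\mathfrak g)\to\Gamma(G\times_H\mathfrak g)$ with $\Phi(x)(g\cdot o)=[(g,x(g))]$ for all $g\in G$, and $\Gamma(G\times_H\mathfrak g)$ with the bracket and the product transported by $\Phi$ is a post-Lie algebra. -/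

import Mathlib

open scoped Manifold ContDiff

/-! ### Post-Lie algebras -/

/-- `br` is a Lie bracket on the `k`-vector space `A`. -/
structure IsLieBracket (k : Type*) {A : Type*} [Field k] [AddCommGroup A] [Module k A]
    (br : A → A → A) : Prop where
  add_left : ∀ x y z, br (x + y) z = br x z + br y z
  smul_left : ∀ (c : k) x y, br (c • x) y = c • br x y
  add_right : ∀ x y z, br x (y + z) = br x y + br x z
  smul_right : ∀ (c : k) x y, br x (c • y) = c • br x y
  self : ∀ x, br x x = 0
  jacobi : ∀ x y z, br (br x y) z + br (br y z) x + br (br z x) y = 0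

/-- The (negative) associator `x * (y * z) - (x * y) * z` of a product. -/
def productAssociator {A : Type*} [AddCommGroup A] (tr : A → A → A) (x y z : A) : A :=
  tr x (tr y z) - tr (tr x y) z

/-- `(A, br, tr)` is a post-Lie algebra over `k`: `br` is a Lie bracket, `tr` is a bilinear
product, `tr x` is a derivation of `br`, and `[x, y] ▷ z = a(x, y, z) - a(y, x, z)`. -/
structure IsPostLie (k : Type*) {A : Type*} [Field k] [AddCommGroup A] [Module k A]
    (br tr : A → A → A) : Prop where
  lie : IsLieBracket k br
  add_left : ∀ x y z, tr (x + y) z = tr x z + tr y z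
  smul_left : ∀ (c : k) x y, tr (c • x) y = c • tr x y
  add_right : ∀ x y z, tr x (y + z) = tr x y + tr x z
  smul_right : ∀ (c : k) x y, tr x (c • y) = c • tr x y
  derivation : ∀ x y z, tr x (br y z) = br (tr x y) z + br y (tr x z)
  bracket_tr : ∀ x y z,
    tr (br x y) z = productAssociator tr x y z - productAssociator tr y x z

noncomputable section

namespace AtiyahPostLie

variable {E : Type*} [NormedAddCommGroup E] [NormedSpace ℝ E]
  {B : Type*} [TopologicalSpace B] {I : ModelWithCorners ℝ E B}
  {G : Type*} [TopologicalSpace G] [ChartedSpace B G] [Group G]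

/-! ### Functions from a Lie group to its Lie algebra

`GroupLieAlgebra I G` is the tangent space of `G` at `1`; its underlying normed space is the model
space `E`, and smoothness of a map into it is smoothness of a map into `E`. -/

/-- The adjoint representation: the derivative at `1` of `a ↦ g * a * g⁻¹`. -/
def Ad (g : G) (v : GroupLieAlgebra I G) : GroupLieAlgebra I G :=
  mfderiv I I (fun a : G => g * a * g⁻¹) 1 v

variable (I G) in
/-- The space of smooth maps from `G` to its Lie algebra. -/
def smoothFunctions : Submodule ℝ (G → GroupLieAlgebra I G) where
  carrier := {x | ContMDiff I 𝓘(ℝ, E) ∞ (M' := E) x}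
  zero_mem' := contMDiff_const (c := (0 : E))
  add_mem' {x y} hx hy := ContMDiff.add (G := E) (f := x) (g := y) hx hy
  smul_mem' c _ hx :=
    (contDiff_const_smul (𝕜 := ℝ) (F := E) (n := ∞) c).contMDiff.comp (I' := 𝓘(ℝ, E)) hx

/-- The vector field `ρ_*(x)` on `G`, whose value at `g` is the image of `x g` under the derivative
of the left translation by `g` (the derivative at `t = 0` of `g * exp (t • x g)`). -/
def rhoStar (x : G → GroupLieAlgebra I G) (g : G) : TangentSpace I g :=
  mulInvariantVectorField (x g) g

/-- The product `x ▷ y = ρ_*(x)(y)`: the derivative of `y` along the vector field `ρ_*(x)`. -/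
def triangle (x y : G → GroupLieAlgebra I G) (g : G) : GroupLieAlgebra I G :=
  mfderiv I 𝓘(ℝ, E) (M' := E) y g (rhoStar x g)

/-- The pointwise bracket of functions with values in the Lie algebra. -/
def bracket (x y : G → GroupLieAlgebra I G) (g : G) : GroupLieAlgebra I G :=
  ⁅x g, y g⁆

theorem Ad_add (g : G) (v w : GroupLieAlgebra I G) : Ad g (v + w) = Ad g v + Ad g w :=
  map_add (mfderiv I I (fun a : G => g * a * g⁻¹) 1) v w

theorem Ad_smul (g : G) (c : ℝ) (v : GroupLieAlgebra I G) : Ad g (c • v) = c • Ad g v :=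
  map_smul (mfderiv I I (fun a : G => g * a * g⁻¹) 1) c v

theorem Ad_zero (g : G) : Ad g (0 : GroupLieAlgebra I G) = 0 :=
  map_zero (mfderiv I I (fun a : G => g * a * g⁻¹) 1)

variable (I) in
/-- The space of smooth functions `x` from `G` to its Lie algebra which are equivariant under the
subgroup `H`: `x (g * h) = Ad_{h⁻¹} (x g)`. -/
def equivariantFunctions (H : Subgroup G) : Submodule ℝ (G → GroupLieAlgebra I G) where
  carrier := {x | x ∈ smoothFunctions I G ∧ ∀ g : G, ∀ h ∈ H, x (g * h) = Ad h⁻¹ (x g)}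
  zero_mem' := ⟨zero_mem _, fun _ h _ => (Ad_zero h⁻¹).symm⟩
  add_mem' {x y} hx hy := ⟨add_mem hx.1 hy.1, fun g h hh => by
    rw [Pi.add_apply, Pi.add_apply, hx.2 g h hh, hy.2 g h hh, Ad_add]⟩
  smul_mem' c x hx := ⟨Submodule.smul_mem _ c hx.1, fun g h hh => by
    rw [Pi.smul_apply, Pi.smul_apply, hx.2 g h hh, Ad_smul]⟩

theorem Ad_one (v : GroupLieAlgebra I G) : Ad (1 : G) v = v := by
  have h : (fun a : G => 1 * a * (1 : G)⁻¹) = id := by ext a; simp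
  unfold Ad
  rw [h, mfderiv_id]
  rfl

theorem Ad_mul [LieGroup I ∞ G] (g h : G) (v : GroupLieAlgebra I G) :
    Ad (g * h) v = Ad g (Ad h v) := by
  have hd : ∀ k : G, MDifferentiable I I (fun a : G => k * a * k⁻¹) := fun k =>
    ((contMDiff_mul_right (I := I) (n := ∞) (a := k⁻¹)).comp
      (contMDiff_mul_left (I := I) (n := ∞) (a := k))).mdifferentiable (by simp)
  have hc : (fun a : G => (g * h) * a * (g * h)⁻¹)
      = (fun a : G => g * a * g⁻¹) ∘ (fun a : G => h * a * h⁻¹) := by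
    ext a; simp [mul_assoc]
  have h1 : ∀ (p : G) (w : E), p = 1 →
      (mfderiv I I (fun a : G => g * a * g⁻¹) p : E →L[ℝ] E) w
        = (mfderiv I I (fun a : G => g * a * g⁻¹) 1 : E →L[ℝ] E) w := by
    rintro p w rfl; rfl
  have h2 : mfderiv I I (fun a : G => (g * h) * a * (g * h)⁻¹) 1
      = (mfderiv I I ((fun a : G => g * a * g⁻¹) ∘ (fun a : G => h * a * h⁻¹)) 1 : E →L[ℝ] E) := by
    rw [hc]
  have h3 : (mfderiv I I ((fun a : G => g * a * g⁻¹) ∘ (fun a : G => h * a * h⁻¹)) 1 :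
      E →L[ℝ] E) = (mfderiv I I (fun a : G => g * a * g⁻¹) (h * 1 * h⁻¹) : E →L[ℝ] E).comp
        (mfderiv I I (fun a : G => h * a * h⁻¹) 1 : E →L[ℝ] E) :=
    mfderiv_comp (I' := I) (1 : G) (hd g _) (hd h _)
  have h4 := congrArg (fun L : E →L[ℝ] E => L v) (h2.trans h3)
  exact h4.trans (h1 _ _ (by simp))

/-! ### The Atiyah bundle of a homogeneous space -/

variable {M : Type*} [MulAction G M] [LieGroup I ∞ G]

variable (I) in
/-- The relation `(g, v) ∼ (g h, Ad_{h⁻¹} v)` for `h` in the isotropy subgroup of `o`. -/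
def atiyahSetoid (o : M) : Setoid (G × GroupLieAlgebra I G) where
  r p q := ∃ h ∈ MulAction.stabilizer G o, q = (p.1 * h, Ad h⁻¹ p.2)
  iseqv :=
    { refl := fun p => ⟨1, one_mem _, by rw [inv_one, Ad_one, mul_one]⟩
      symm := by
        rintro p q ⟨h, hh, rfl⟩
        refine ⟨h⁻¹, inv_mem hh, ?_⟩
        rw [← Ad_mul]
        simp [Ad_one]
      trans := by
        rintro p q r ⟨h, hh, rfl⟩ ⟨k, hk, rfl⟩
        refine ⟨h * k, mul_mem hh hk, ?_⟩
        rw [← Ad_mul, mul_inv_rev, mul_assoc] }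

variable (I) in
/-- The total space `G ×_H 𝔤` of the Atiyah bundle, `H` being the isotropy subgroup of `o`. -/
def AtiyahBundle (o : M) : Type _ := Quotient (atiyahSetoid (G := G) I o)

/-- The class of `(g, v)` in `G ×_H 𝔤`. -/
def AtiyahBundle.mk (o : M) (g : G) (v : GroupLieAlgebra I G) : AtiyahBundle (G := G) I o :=
  Quotient.mk (atiyahSetoid I o) (g, v)

theorem AtiyahBundle.mk_eq_iff {o : M} {g g' : G} {v v' : GroupLieAlgebra I G} :
    AtiyahBundle.mk o g v = AtiyahBundle.mk o g' v' ↔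
      ∃ h ∈ MulAction.stabilizer G o, g' = g * h ∧ v' = Ad h⁻¹ v := by
  refine Quotient.eq.trans ?_
  exact exists_congr fun h => and_congr_right fun _ => Prod.mk_inj

/-- The projection `G ×_H 𝔤 → M`, `(g, v) ↦ g • o`. -/
def AtiyahBundle.proj (o : M) : AtiyahBundle (G := G) I o → M :=
  Quotient.lift (fun p => p.1 • o) (by
    rintro p q ⟨h, hh, rfl⟩
    rw [mul_smul, MulAction.mem_stabilizer_iff.mp hh])

variable (I G) in
/-- The fibre of `G ×_H 𝔤` over `u`. -/
def AtiyahFiber (o u : M) : Type _ := {q : AtiyahBundle (G := G) I o // q.proj o = u}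

/-- The class of `(g, v)` as a point of the fibre over `u = g • o`. -/
def AtiyahFiber.mk {o u : M} (g : G) (hg : g • o = u) (v : GroupLieAlgebra I G) :
    AtiyahFiber I G o u :=
  ⟨AtiyahBundle.mk o g v, hg⟩

/-- If `g • o = u`, then `v ↦ [(g, v)]` is a bijection from the Lie algebra to the fibre. -/
theorem AtiyahFiber.mk_bijective {o u : M} (g : G) (hg : g • o = u) :
    Function.Bijective (AtiyahFiber.mk (I := I) g hg) := by
  constructor
  · intro v w hvw
    obtain ⟨h, -, h1, h2⟩ := AtiyahBundle.mk_eq_iff.mp (congrArg (fun q : AtiyahFiber I G o u => q.1) hvw)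
    have h3 : h = 1 := by simpa using h1
    rw [h2, h3, inv_one, Ad_one]
  · rintro ⟨q, hq⟩
    induction q using Quotient.inductionOn with
    | h p =>
      obtain ⟨k, w⟩ := p
      have hk : k • o = u := hq
      refine ⟨Ad (g⁻¹ * k) w, Subtype.ext ?_⟩
      refine AtiyahBundle.mk_eq_iff.mpr ⟨g⁻¹ * k, ?_, by group, ?_⟩
      · rw [MulAction.mem_stabilizer_iff, mul_smul, hk, ← hg, inv_smul_smul]
      · rw [← Ad_mul, inv_mul_cancel, Ad_one]

section Fiber

variable [MulAction.IsPretransitive G M]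

/-- An identification of the fibre over `u` with the Lie algebra, by a choice of `g` with
`g • o = u`. It serves to define the vector space structure of the fibre, which does not depend on
the choice: see `AtiyahFiber.mk_add` and `AtiyahFiber.mk_smul`. -/
def fiberEquiv (o u : M) : AtiyahFiber I G o u ≃ GroupLieAlgebra I G :=
  (Equiv.ofBijective _ (AtiyahFiber.mk_bijective (I := I)
    (MulAction.exists_smul_eq G o u).choose (MulAction.exists_smul_eq G o u).choose_spec)).symm

instance (o u : M) : AddCommGroup (AtiyahFiber I G o u) := (fiberEquiv o u).addCommGroup

instance (o u : M) : Module ℝ (AtiyahFiber I G o u) := (fiberEquiv o u).module ℝ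

theorem fiberEquiv_mk {o u : M} (g : G) (hg : g • o = u) (v : GroupLieAlgebra I G) :
    fiberEquiv o u (AtiyahFiber.mk g hg v)
      = Ad ((MulAction.exists_smul_eq G o u).choose⁻¹ * g) v := by
  have hk : (MulAction.exists_smul_eq G o u).choose • o = u :=
    (MulAction.exists_smul_eq G o u).choose_spec
  rw [← Equiv.eq_symm_apply]
  refine Subtype.ext (Eq.symm ?_)
  refine AtiyahBundle.mk_eq_iff.mpr
    ⟨(MulAction.exists_smul_eq G o u).choose⁻¹ * g, ?_, by group, ?_⟩
  · rw [MulAction.mem_stabilizer_iff, mul_smul, hg, inv_smul_eq_iff, hk]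
  · rw [← Ad_mul, inv_mul_cancel, Ad_one]

theorem AtiyahFiber.mk_add {o u : M} (g : G) (hg : g • o = u) (v w : GroupLieAlgebra I G) :
    AtiyahFiber.mk g hg (v + w) = AtiyahFiber.mk g hg v + AtiyahFiber.mk g hg w := by
  apply (fiberEquiv o u).injective
  rw [Equiv.add_def, Equiv.apply_symm_apply, fiberEquiv_mk, fiberEquiv_mk, fiberEquiv_mk, Ad_add]

theorem AtiyahFiber.mk_smul {o u : M} (g : G) (hg : g • o = u) (c : ℝ)
    (v : GroupLieAlgebra I G) :
    AtiyahFiber.mk g hg (c • v) = c • AtiyahFiber.mk g hg v := by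
  apply (fiberEquiv o u).injective
  rw [Equiv.smul_def, Equiv.apply_symm_apply, fiberEquiv_mk, fiberEquiv_mk, Ad_smul]

theorem AtiyahFiber.mk_zero {o u : M} (g : G) (hg : g • o = u) :
    AtiyahFiber.mk g hg (0 : GroupLieAlgebra I G) = 0 := by
  have h := AtiyahFiber.mk_smul (I := I) g hg 0 0
  rwa [zero_smul, zero_smul] at h

end Fiber

variable {E' : Type*} [NormedAddCommGroup E'] [NormedSpace ℝ E']
  {B' : Type*} [TopologicalSpace B'] {I' : ModelWithCorners ℝ E' B'}
  [TopologicalSpace M] [ChartedSpace B' M]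

variable (I I') in
/-- A Cartan gauge `(σ, U)`: a smooth local section over the open set `U` of the principal
`H`-bundle `G → M`, `g ↦ g • o`. -/
structure IsCartanGauge (o : M) (U : Set M) (σ : M → G) : Prop where
  isOpen : IsOpen U
  smooth : ContMDiffOn I' I ∞ σ U
  smul_eq : ∀ u ∈ U, σ u • o = u

variable (I') in
/-- A section `X` of `G ×_H 𝔤` is smooth if it is smooth in each local trivialization
`(u, v) ↦ [(σ u, v)]` of the bundle, that is, for each Cartan gauge `(σ, U)` it has the form
`X u = [(σ u, f u)]` on `U` with a smooth function `f` on `U`. -/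
def IsSmoothSection {o : M} (X : (u : M) → AtiyahFiber I G o u) : Prop :=
  ∀ (U : Set M) (σ : M → G), IsCartanGauge I I' o U σ →
    ∃ f : M → GroupLieAlgebra I G, ContMDiffOn I' 𝓘(ℝ, E) ∞ (M' := E) f U ∧
      ∀ (u : M) (hu : σ u • o = u), u ∈ U → X u = AtiyahFiber.mk (σ u) hu (f u)

variable (I I' G) in
/-- The space of smooth sections of `G ×_H 𝔤`, with its pointwise vector space structure. -/
def smoothSections [MulAction.IsPretransitive G M] (o : M) :
    Submodule ℝ ((u : M) → AtiyahFiber I G o u) where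
  carrier := {X | IsSmoothSection I' X}
  zero_mem' := fun _ σ _ => ⟨fun _ => 0, contMDiffOn_const (c := (0 : E)),
    fun u hu _ => (AtiyahFiber.mk_zero (σ u) hu).symm⟩
  add_mem' {X Y} hX hY := fun U σ hσ => by
    obtain ⟨f, hf, hfX⟩ := hX U σ hσ
    obtain ⟨k, hk, hkY⟩ := hY U σ hσ
    refine ⟨fun u => f u + k u, ContMDiffOn.add (G := E) (f := f) (g := k) hf hk,
      fun u hu hU => ?_⟩
    rw [Pi.add_apply, hfX u hu hU, hkY u hu hU, AtiyahFiber.mk_add]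
  smul_mem' c X hX := fun U σ hσ => by
    obtain ⟨f, hf, hfX⟩ := hX U σ hσ
    refine ⟨fun u => c • f u, (contDiff_const_smul (𝕜 := ℝ) (F := E) (n := ∞) c).contMDiff.comp_contMDiffOn
      (I' := 𝓘(ℝ, E)) hf,
      fun u hu hU => ?_⟩
    rw [Pi.smul_apply, hfX u hu hU, AtiyahFiber.mk_smul]

end AtiyahPostLie

end

/-! ### Maps of constant rank -/

open Module Topology

section ConstantRank

variable {E F : Type*} [NormedAddCommGroup E] [NormedSpace ℝ E] [FiniteDimensional ℝ E]
  [NormedAddCommGroup F] [NormedSpace ℝ F] [FiniteDimensional ℝ F]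

/-! In the left trivialization the product is `x ▷ y = Dy(x)`, where `D` is `leftDeriv`: the value
at `g` involves `x` only through `x g`. Since the bracket is a constant bilinear map of the Lie
algebra, the derivation rule is the Leibniz rule. In the associator of `x, y, z` the terms
containing `Dy` cancel, and what remains is the second derivative `D²z(x, y)`
(`triangle_associator`). Its antisymmetric part is `Dz([x, y])`, because left-invariant fields act
on functions as derivations and their commutator is the left-invariant field of the bracket
(`leftDeriv_leftDeriv_sub`). This is the second post-Lie identity, and it uses no equivariance.
Equivariance is preserved by the bracket because `Ad` respects brackets (`Ad_bracket`), and by the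
product because `D` intertwines `Ad` (`leftDeriv_comp_Ad`).

A section `X` corresponds to the function `x` for which `x g` is the unique vector with `[(g, x g)]
= X (g • o)`. The one hard point is the smoothness of `x`. Smoothness of `X` is tested in Cartan
gauges, so every point of `M` must lie in the domain of one; given a gauge `σ` with local form `f`,
the formula `x g = Ad (g⁻¹ σ(g • o)) (f (g • o))` shows that `x` is smooth there.

Gauges exist because the orbit map is a submersion. By equivariance it has constant rank `r`, so
locally its image has Hausdorff dimension at most `r`. As `G` is second countable, countably many
such images cover a chart of `M`, and therefore `dim M ≤ r`. This argument replaces Sard's theorem.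
-/

theorem ContinuousLinearMap.apply_eq_zero_of_finrank_range_le {R Y : Type*}
    [NormedAddCommGroup R] [NormedSpace ℝ R] [FiniteDimensional ℝ R]
    [NormedAddCommGroup Y] [NormedSpace ℝ Y] {A : Y →L[ℝ] F} {P : F →L[ℝ] R}
    (hP : Function.Surjective (P ∘L A))
    (hA : finrank ℝ (LinearMap.range (A : Y →ₗ[ℝ] F)) ≤ finrank ℝ R) {v : Y}
    (hv : P (A v) = 0) : A v = 0 := by
  let T : LinearMap.range (A : Y →ₗ[ℝ] F) →ₗ[ℝ] R :=
    (P : F →ₗ[ℝ] R).comp (LinearMap.range (A : Y →ₗ[ℝ] F)).subtype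
  have hT : Function.Surjective T := fun r => by
    obtain ⟨y, hy⟩ := hP r
    exact ⟨⟨A y, y, rfl⟩, hy⟩
  -- `P` maps the range of `A` onto `R`; the rank bound leaves no room for a kernel, so `P` is
  -- injective on that range.
  have h1 : finrank ℝ (LinearMap.range (A : Y →ₗ[ℝ] F)) = finrank ℝ R :=
    le_antisymm hA (LinearMap.finrank_le_finrank_of_surjective hT)
  have h2 : Function.Injective T :=
    (LinearMap.injective_iff_surjective_of_finrank_eq_finrank h1).2 hT
  have h3 : (⟨A v, v, rfl⟩ : LinearMap.range (A : Y →ₗ[ℝ] F)) = 0 := h2 (by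
    rw [map_zero]
    exact hv)
  exact congrArg Subtype.val h3

/-- The image of a small neighbourhood of a point near which a `C^1` map has its rank bounded by the
rank at that point has Hausdorff dimension at most that rank. -/
theorem ContDiffAt.exists_mem_nhds_dimH_image_le {f : E → F} {x₀ : E} (hf : ContDiffAt ℝ 1 f x₀)
    (hr : ∀ᶠ x in 𝓝 x₀, finrank ℝ (LinearMap.range (fderiv ℝ f x : E →ₗ[ℝ] F)) ≤
      finrank ℝ (LinearMap.range (fderiv ℝ f x₀ : E →ₗ[ℝ] F))) :
    ∃ V ∈ 𝓝 x₀,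
      dimH (f '' V) ≤ finrank ℝ (LinearMap.range (fderiv ℝ f x₀ : E →ₗ[ℝ] F)) := by
  set D : E →L[ℝ] F := fderiv ℝ f x₀ with hD
  set R := LinearMap.range (D : E →ₗ[ℝ] F) with hR
  set K := LinearMap.ker (D : E →ₗ[ℝ] F) with hK
  obtain ⟨P', hP'⟩ := R.subtype.exists_leftInverse_of_injective R.ker_subtype
  obtain ⟨Q', hQ'⟩ := K.subtype.exists_leftInverse_of_injective K.ker_subtype
  let P : F →L[ℝ] R := LinearMap.toContinuousLinearMap P'
  let Q : E →L[ℝ] K := LinearMap.toContinuousLinearMap Q'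
  have hP : ∀ v : R, P v = v := fun v => LinearMap.congr_fun hP' v
  have hQ : ∀ v : K, Q v = v := fun v => LinearMap.congr_fun hQ' v
  -- `P` and `Q` are projections onto the range and the kernel of `D`. The map `T` will be the
  -- derivative at `x₀` of the straightening coordinates `φ = (P ∘ f, Q)`; it is injective between
  -- spaces of equal dimension.
  let T : E →L[ℝ] R × K := (P ∘L D).prod Q
  have hTinj : Function.Injective T := by
    refine (injective_iff_map_eq_zero T).2 fun v hv => ?_
    have h1 : P (D v) = 0 := congrArg Prod.fst hv
    have h2 : Q v = 0 := congrArg Prod.snd hv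
    have h3 : (⟨D v, v, rfl⟩ : R) = 0 := (hP ⟨D v, v, rfl⟩).symm.trans h1
    have h4 : v ∈ K := congrArg Subtype.val h3
    have h5 : (⟨v, h4⟩ : K) = 0 := (hQ ⟨v, h4⟩).symm.trans h2
    exact congrArg Subtype.val h5
  have hfin : finrank ℝ E = finrank ℝ (R × K) := by
    rw [finrank_prod, LinearMap.finrank_range_add_finrank_ker]
  let T' : E ≃L[ℝ] R × K :=
    (LinearEquiv.ofInjectiveOfFinrankEq (T : E →ₗ[ℝ] R × K) hTinj hfin).toContinuousLinearEquiv
  have hT' : (T' : E →L[ℝ] R × K) = T := by ext v <;> rfl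
  let φ : E → R × K := fun x => (P (f x), Q x)
  have hφ : ContDiffAt ℝ 1 φ x₀ := (P.contDiff.contDiffAt.comp x₀ hf).prodMk Q.contDiff.contDiffAt
  have hφ' : HasFDerivAt φ (T' : E →L[ℝ] R × K) x₀ := by
    rw [hT']
    exact (P.hasFDerivAt.comp x₀ (hf.differentiableAt one_ne_zero).hasFDerivAt).prodMk Q.hasFDerivAt
  let e := hφ.toOpenPartialHomeomorph φ hφ' one_ne_zero
  have he : ∀ x, e x = φ x := fun x => rfl
  have hx₀ : x₀ ∈ e.source := hφ.mem_toOpenPartialHomeomorph_source hφ' one_ne_zero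
  have hy₀ : φ x₀ ∈ e.target := hφ.image_mem_toOpenPartialHomeomorph_target hφ' one_ne_zero
  have hψ₀ : e.symm (φ x₀) = x₀ := e.left_inv hx₀
  have hψ : ContDiffAt ℝ 1 e.symm (φ x₀) := hφ.to_localInverse hφ' one_ne_zero
  have hlim : Filter.Tendsto e.symm (𝓝 (φ x₀)) (𝓝 x₀) := by
    have := hψ.continuousAt.tendsto
    rwa [hψ₀] at this
  have hev : ∀ᶠ y in 𝓝 (φ x₀), y ∈ e.target ∧ ContDiffAt ℝ 1 e.symm y ∧
      ContDiffAt ℝ 1 f (e.symm y) ∧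
      finrank ℝ (LinearMap.range (fderiv ℝ f (e.symm y) : E →ₗ[ℝ] F)) ≤ finrank ℝ R :=
    (e.open_target.eventually_mem hy₀).and ((hψ.eventually (by simp)).and
      (hlim.eventually ((hf.eventually (by simp)).and hr)))
  obtain ⟨ε, hε, hball⟩ := Metric.eventually_nhds_iff_ball.1 hev
  have hh : ∀ y ∈ Metric.ball (φ x₀) ε, ContDiffAt ℝ 1 (f ∘ e.symm) y := fun y hy =>
    (hball y hy).2.2.1.comp y (hball y hy).2.1
  -- In the new coordinates `P ∘ f` is the first projection. Its derivative kills `(0, b)`, and the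
  -- rank bound then forces the derivative of `f` itself to kill `(0, b)`.
  have hzero : ∀ y ∈ Metric.ball (φ x₀) ε, ∀ b : K, fderiv ℝ (f ∘ e.symm) y (0, b) = 0 := by
    intro y hy b
    obtain ⟨h1, h2, h3, h4⟩ := hball y hy
    have hPh : P ∘L fderiv ℝ (f ∘ e.symm) y = ContinuousLinearMap.fst ℝ R K := by
      have h5 : HasFDerivAt (P ∘ (f ∘ e.symm)) (P ∘L fderiv ℝ (f ∘ e.symm) y) y :=
        P.hasFDerivAt.comp y ((hh y hy).differentiableAt one_ne_zero).hasFDerivAt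
      refine h5.unique (hasFDerivAt_fst.congr_of_eventuallyEq ?_)
      filter_upwards [e.open_target.mem_nhds h1] with z hz
      exact congrArg Prod.fst (e.right_inv hz)
    refine ContinuousLinearMap.apply_eq_zero_of_finrank_range_le (P := P) ?_ ?_ ?_
    · rw [hPh]
      exact Prod.fst_surjective
    · refine le_trans (Submodule.finrank_mono ?_) h4
      rw [fderiv_comp y (h3.differentiableAt one_ne_zero) (h2.differentiableAt one_ne_zero)]
      exact LinearMap.range_comp_le_range (fderiv ℝ e.symm y : R × K →ₗ[ℝ] E) _
    · exact DFunLike.congr_fun hPh (0, b)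
  -- For the sup norm a ball of the product is a product of balls, so its slices in the `K`
  -- direction are convex and `f` is constant along them.
  have hmem : ∀ (a : R) (b : K), (a, b) ∈ Metric.ball (φ x₀) ε ↔
      a ∈ Metric.ball (φ x₀).1 ε ∧ b ∈ Metric.ball (φ x₀).2 ε := fun a b => by
    rw [← ball_prod_same]
    exact Set.mem_prod
  have hconst : ∀ (a : R) (b : K), (a, b) ∈ Metric.ball (φ x₀) ε →
      f (e.symm (a, b)) = f (e.symm (a, (φ x₀).2)) := by
    intro a b hab
    have hd : ∀ b' ∈ Metric.ball (φ x₀).2 ε,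
        HasFDerivAt (fun b' => (f ∘ e.symm) (a, b')) (0 : K →L[ℝ] F) b' := by
      intro b' hb'
      have h1 : (a, b') ∈ Metric.ball (φ x₀) ε := (hmem a b').2 ⟨((hmem a b).1 hab).1, hb'⟩
      have h2 := ((hh _ h1).differentiableAt one_ne_zero).hasFDerivAt.comp b'
        (hasFDerivAt_prodMk_right a b')
      convert! h2 using 1
      ext c
      exact (hzero _ h1 c).symm
    refine (convex_ball (φ x₀).2 ε).is_const_of_fderivWithin_eq_zero
      (f := fun b' => (f ∘ e.symm) (a, b')) (𝕜 := ℝ)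
      (fun b' hb' => (hd b' hb').differentiableAt.differentiableWithinAt) (fun b' hb' => ?_)
      ((hmem a b).1 hab).2 (Metric.mem_ball_self hε)
    rw [fderivWithin_of_isOpen Metric.isOpen_ball hb', (hd b' hb').fderiv]
  refine ⟨e.source ∩ φ ⁻¹' Metric.ball (φ x₀) ε, Filter.inter_mem (e.open_source.mem_nhds hx₀)
    (hφ.continuousAt.preimage_mem_nhds (Metric.ball_mem_nhds _ hε)), ?_⟩
  have hsub : f '' (e.source ∩ φ ⁻¹' Metric.ball (φ x₀) ε) ⊆
      (fun a : R => (f ∘ e.symm) (a, (φ x₀).2)) '' Metric.ball (φ x₀).1 ε := by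
    rintro _ ⟨x, ⟨hx, hxb⟩, rfl⟩
    refine ⟨(φ x).1, ((hmem (φ x).1 (φ x).2).1 hxb).1, ?_⟩
    refine (hconst (φ x).1 (φ x).2 hxb).symm.trans ?_
    exact congrArg f (e.left_inv hx)
  refine (dimH_mono hsub).trans ?_
  refine (ContDiffOn.dimH_image_le (s := Metric.ball (φ x₀).1 ε) ?_ (convex_ball _ _)
    subset_rfl).trans ?_
  · intro a ha
    exact ((hh (a, (φ x₀).2) ((hmem _ _).2 ⟨ha, Metric.mem_ball_self hε⟩)).comp a
      (contDiffAt_id.prodMk contDiffAt_const)).contDiffWithinAt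
  · exact (dimH_mono (Set.subset_univ _)).trans (Real.dimH_univ_eq_finrank R).le

end ConstantRank

/-! ### The orbit map of a transitive action is a submersion -/

open Module Topology

section Rank

/-- The range of the composite is the image of the range of `L` under the injective `A`. This gives
invariance of rank both under change of charts and under translations. -/
theorem ContinuousLinearMap.finrank_range_comp_comp {V₁ V₂ V₃ V₄ : Type*}
    [AddCommGroup V₁] [Module ℝ V₁] [TopologicalSpace V₁]
    [AddCommGroup V₂] [Module ℝ V₂] [TopologicalSpace V₂]
    [AddCommGroup V₃] [Module ℝ V₃] [TopologicalSpace V₃]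
    [AddCommGroup V₄] [Module ℝ V₄] [TopologicalSpace V₄]
    {A : V₃ →L[ℝ] V₄} (L : V₂ →L[ℝ] V₃) {C : V₁ →L[ℝ] V₂}
    (hA : Function.Injective A) (hC : Function.Surjective C) :
    finrank ℝ (LinearMap.range ((A ∘L L ∘L C : V₁ →L[ℝ] V₄) : V₁ →ₗ[ℝ] V₄)) =
      finrank ℝ (LinearMap.range (L : V₂ →ₗ[ℝ] V₃)) := by
  have h : LinearMap.range ((A ∘L L ∘L C : V₁ →L[ℝ] V₄) : V₁ →ₗ[ℝ] V₄) =
      (LinearMap.range (L : V₂ →ₗ[ℝ] V₃)).map (A : V₃ →ₗ[ℝ] V₄) := by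
    ext w
    constructor
    · rintro ⟨v, rfl⟩
      exact ⟨L (C v), ⟨C v, rfl⟩, rfl⟩
    · rintro ⟨_, ⟨v, rfl⟩, rfl⟩
      obtain ⟨u, rfl⟩ := hC v
      exact ⟨u, rfl⟩
  rw [h]
  exact (LinearEquiv.finrank_eq (Submodule.equivMapOfInjective _ hA _)).symm

variable {E : Type*} [NormedAddCommGroup E] [NormedSpace ℝ E]
  {B : Type*} [TopologicalSpace B] {I : ModelWithCorners ℝ E B}
  {N : Type*} [TopologicalSpace N] [ChartedSpace B N]
  {E' : Type*} [NormedAddCommGroup E'] [NormedSpace ℝ E']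
  {B' : Type*} [TopologicalSpace B'] {I' : ModelWithCorners ℝ E' B'}
  {M : Type*} [TopologicalSpace M] [ChartedSpace B' M]

variable (I I') in
/-- The derivative of a map between manifolds, as a map between the model spaces. -/
noncomputable def modelDeriv (f : N → M) (x : N) : E →L[ℝ] E' := mfderiv I I' f x

theorem modelDeriv_comp {E'' : Type*} [NormedAddCommGroup E''] [NormedSpace ℝ E'']
    {B'' : Type*} [TopologicalSpace B''] {I'' : ModelWithCorners ℝ E'' B''}
    {M' : Type*} [TopologicalSpace M'] [ChartedSpace B'' M'] {g : M → M'} {f : N → M} (x : N)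
    (hg : MDifferentiableAt I' I'' g (f x)) (hf : MDifferentiableAt I I' f x) :
    modelDeriv I I'' (g ∘ f) x = modelDeriv I' I'' g (f x) ∘L modelDeriv I I' f x :=
  mfderiv_comp x hg hf

variable [I.Boundaryless] [IsManifold I 1 N] [IsManifold I' 1 M]

theorem mdifferentiableAt_extChartAt_symm_of_boundaryless {p : N} {y : E}
    (hy : y ∈ (extChartAt I p).target) :
    MDifferentiableAt 𝓘(ℝ, E) I (extChartAt I p).symm y :=
  ((contMDiffOn_extChartAt_symm (n := 1) p).contMDiffAt
    ((isOpen_extChartAt_target p).mem_nhds hy)).mdifferentiableAt one_ne_zero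

/-- The derivative of a map between manifolds, read in charts. -/
theorem fderiv_chart_comp {f : N → M} {p : N} {q : M} {y : E} (hy : y ∈ (extChartAt I p).target)
    (hq : f ((extChartAt I p).symm y) ∈ (extChartAt I' q).source)
    (hf : MDifferentiableAt I I' f ((extChartAt I p).symm y)) :
    ∃ (A : E' →L[ℝ] E') (C : E →L[ℝ] E), Function.Bijective A ∧ Function.Bijective C ∧
      fderiv ℝ (extChartAt I' q ∘ f ∘ (extChartAt I p).symm) y =
        A ∘L modelDeriv I I' f ((extChartAt I p).symm y) ∘L C := by
  have h1 := mdifferentiableAt_extChartAt_symm_of_boundaryless (I := I) hy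
  have h2 : MDifferentiableAt I' 𝓘(ℝ, E') (extChartAt I' q) (f ((extChartAt I p).symm y)) :=
    mdifferentiableAt_extChartAt (by rwa [extChartAt_source] at hq)
  refine ⟨modelDeriv I' 𝓘(ℝ, E') (extChartAt I' q) (f ((extChartAt I p).symm y)),
    modelDeriv 𝓘(ℝ, E) I (extChartAt I p).symm y, ?_, ?_, ?_⟩
  · obtain ⟨a, ha⟩ := isInvertible_mfderiv_extChartAt (I := I') hq
    have h3 := a.bijective
    rw [← ContinuousLinearEquiv.coe_coe, ha] at h3
    exact h3
  · have h3 := isInvertible_mfderivWithin_extChartAt_symm (I := I) hy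
    rw [I.range_eq_univ, mfderivWithin_univ] at h3
    obtain ⟨c, hc⟩ := h3
    have h4 := c.bijective
    rw [← ContinuousLinearEquiv.coe_coe, hc] at h4
    exact h4
  · rw [← mfderiv_eq_fderiv]
    refine (modelDeriv_comp (I' := I') y h2 (hf.comp y h1)).trans ?_
    rw [modelDeriv_comp (I' := I) y hf h1]
    rfl

variable [FiniteDimensional ℝ E']

/-- A submersion has local sections. -/
theorem ContMDiff.exists_local_section {n : ℕ∞ω} [IsManifold I n N] [IsManifold I' n M]
    {f : N → M} (hf : ContMDiff I I' n f) (hn : n ≠ 0) {x : N}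
    (hx : Function.Surjective (modelDeriv I I' f x)) :
    ∃ (U : Set M) (σ : M → N), IsOpen U ∧ f x ∈ U ∧ ContMDiffOn I' I n σ U ∧
      ∀ u ∈ U, f (σ u) = u := by
  set c := extChartAt I x
  set d := extChartAt I' (f x)
  set y₀ := c x
  have hy₀ : c.symm y₀ = x := extChartAt_to_inv x
  let k : E → E' := d ∘ f ∘ c.symm
  obtain ⟨A, C, hA, hC, hAC⟩ := fderiv_chart_comp (I := I) (I' := I') (f := f) (p := x)
    (q := f x) (y := y₀) (mem_extChartAt_target x) (by
      change f (c.symm y₀) ∈ _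
      rw [hy₀]
      exact mem_extChartAt_source (f x)) (hf.mdifferentiable hn _)
  have hD : Function.Surjective (fderiv ℝ k y₀) := by
    have h1 : fderiv ℝ k y₀ = A ∘L modelDeriv I I' f (c.symm y₀) ∘L C := hAC
    rw [h1, hy₀]
    exact hA.2.comp (hx.comp hC.2)
  obtain ⟨R, hR⟩ := (fderiv ℝ k y₀).exists_rightInverse_of_surjective (LinearMap.range_eq_top.2 hD)
  let S : Set E := c.target ∩ c.symm ⁻¹' (f ⁻¹' d.source)
  have hS : IsOpen S := (continuousOn_extChartAt_symm x).isOpen_inter_preimage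
    (isOpen_extChartAt_target x) ((isOpen_extChartAt_source (f x)).preimage hf.continuous)
  have hkS : ∀ y ∈ S, ContDiffAt ℝ n k y := by
    rintro y ⟨hy, hyd⟩
    rw [← contMDiffAt_iff_contDiffAt]
    refine ContMDiffAt.comp (I' := I') _ ?_ (ContMDiffAt.comp (I' := I) _ hf.contMDiffAt
      ((contMDiffOn_extChartAt_symm (n := n) x).contMDiffAt
        ((isOpen_extChartAt_target x).mem_nhds hy)))
    refine contMDiffAt_extChartAt' ?_
    rw [← extChartAt_source I']
    exact hyd
  have hyS : y₀ ∈ S := ⟨mem_extChartAt_target x, by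
    rw [Set.mem_preimage, hy₀]
    exact mem_extChartAt_source (f x)⟩
  -- An affine slice transverse to the fibre: `R` is a right inverse of the derivative of `k`, so `k
  -- ∘ a` has derivative the identity at `0` and the inverse function theorem applies.
  let a : E' → E := fun z => y₀ + R z
  have ha : ContDiff ℝ n a := contDiff_const.add R.contDiff
  have ha0 : a 0 = y₀ := by simp [a]
  let W : Set E' := a ⁻¹' S
  have hW : IsOpen W := hS.preimage ha.continuous
  have hj : ∀ z ∈ W, ContDiffAt ℝ n (k ∘ a) z := fun z hz => (hkS _ hz).comp z ha.contDiffAt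
  have h0W : (0 : E') ∈ W := by
    rw [Set.mem_preimage, ha0]
    exact hyS
  have hj' : HasFDerivAt (k ∘ a) (ContinuousLinearEquiv.refl ℝ E' : E' →L[ℝ] E') 0 := by
    have h1 : HasFDerivAt a R 0 := R.hasFDerivAt.const_add y₀
    have h2 : HasFDerivAt k (fderiv ℝ k y₀) (a 0) := by
      rw [ha0]
      exact ((hkS y₀ hyS).differentiableAt hn).hasFDerivAt
    have h3 := h2.comp 0 h1
    rwa [hR] at h3
  let e := (hj 0 h0W).toOpenPartialHomeomorph (k ∘ a) hj' hn
  have he0 : (0 : E') ∈ e.source := (hj 0 h0W).mem_toOpenPartialHomeomorph_source hj' hn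
  -- For `n = ∞`, being `C^n` at one point does not give it on a neighbourhood. Restricting to the
  -- open set where the derivative is invertible makes the local inverse `C^n` at every point.
  let P : Set E' := W ∩ (fderiv ℝ (k ∘ a)) ⁻¹' Set.range ((↑) : (E' ≃L[ℝ] E') → E' →L[ℝ] E')
  have hP : IsOpen P := by
    refine ContinuousOn.isOpen_inter_preimage ?_ hW ContinuousLinearEquiv.isOpen
    intro z hz
    exact ((hj z hz).continuousAt_fderiv hn).continuousWithinAt
  have h0P : (0 : E') ∈ P := ⟨h0W, ContinuousLinearEquiv.refl ℝ E', hj'.fderiv.symm⟩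
  let T : Set E' := e.target ∩ e.symm ⁻¹' P
  have hT : IsOpen T := e.isOpen_inter_preimage_symm hP
  have hψ : ∀ w ∈ T, ContDiffAt ℝ n e.symm w := by
    rintro w ⟨hw, hwP, L, hL⟩
    refine e.contDiffAt_symm (f₀' := L) hw ?_ (hj _ hwP)
    rw [hL]
    exact ((hj _ hwP).differentiableAt hn).hasFDerivAt
  have hd0 : d (f x) = e 0 := by
    change d (f x) = d (f (c.symm (a 0)))
    rw [ha0, hy₀]
  refine ⟨d.source ∩ d ⁻¹' T, fun u => c.symm (a (e.symm (d u))),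
    isOpen_extChartAt_preimage' (f x) hT, ⟨mem_extChartAt_source (f x), ?_⟩, ?_, ?_⟩
  · rw [Set.mem_preimage, hd0]
    refine ⟨e.map_source he0, ?_⟩
    rw [Set.mem_preimage, e.left_inv he0]
    exact h0P
  · rintro u ⟨hu, hw, huP⟩
    have h1 : ContMDiffAt I' 𝓘(ℝ, E') n d u :=
      contMDiffAt_extChartAt' (by rwa [← extChartAt_source I'])
    have h2 : ContMDiffAt I' 𝓘(ℝ, E) n (fun u => a (e.symm (d u))) u :=
      (ha.contDiffAt.comp _ (hψ _ ⟨hw, huP⟩)).contMDiffAt.comp u h1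
    have h3 : ContMDiffAt 𝓘(ℝ, E) I n c.symm (a (e.symm (d u))) :=
      (contMDiffOn_extChartAt_symm (n := n) x).contMDiffAt
        ((isOpen_extChartAt_target x).mem_nhds huP.1.1)
    exact (ContMDiffAt.comp u h3 h2).contMDiffWithinAt
  · rintro u ⟨hu, hw, huP⟩
    exact d.injOn huP.1.2 hu (e.right_inv hw)

variable [I'.Boundaryless] [FiniteDimensional ℝ E]

/-- A surjective `C^1` map of constant rank from a second countable manifold is a submersion. -/
theorem Function.Surjective.surjective_mfderiv_of_constant_rank [SecondCountableTopology N]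
    {f : N → M} (hs : Function.Surjective f) (hf : ContMDiff I I' 1 f) {r : ℕ}
    (hr : ∀ x, finrank ℝ (LinearMap.range (modelDeriv I I' f x : E →ₗ[ℝ] E')) = r)
    (x : N) : Function.Surjective (modelDeriv I I' f x) := by
  have hrE : finrank ℝ E' ≤ r := by
    set q := f x
    have hloc : ∀ p ∈ f ⁻¹' (extChartAt I' q).source,
        ∃ V ∈ 𝓝 p, dimH ((extChartAt I' q ∘ f) '' V) ≤ r := by
      intro p hp
      let k : E → E' := extChartAt I' q ∘ f ∘ (extChartAt I p).symm
      have hpp : (extChartAt I p).symm (extChartAt I p p) = p := extChartAt_to_inv p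
      have hk : ContDiffAt ℝ 1 k (extChartAt I p p) := by
        rw [← contMDiffAt_iff_contDiffAt]
        refine ContMDiffAt.comp (I' := I') _ ?_ (ContMDiffAt.comp (I' := I) _ hf.contMDiffAt
          ((contMDiffOn_extChartAt_symm (n := 1) p).contMDiffAt
            ((isOpen_extChartAt_target p).mem_nhds (mem_extChartAt_target p))))
        refine contMDiffAt_extChartAt' ?_
        rw [Function.comp_apply, hpp, ← extChartAt_source I']
        exact hp
      have hrk : ∀ y ∈ (extChartAt I p).target, f ((extChartAt I p).symm y) ∈
          (extChartAt I' q).source →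
          finrank ℝ (LinearMap.range (fderiv ℝ k y : E →ₗ[ℝ] E')) = r := by
        intro y hy hyq
        obtain ⟨A, C, hA, hC, h⟩ := fderiv_chart_comp (I := I) (I' := I') hy hyq
          (hf.mdifferentiable one_ne_zero _)
        have h' : fderiv ℝ k y = _ := h
        rw [h', ContinuousLinearMap.finrank_range_comp_comp _ hA.1 hC.2, hr]
      have hrp := hrk (extChartAt I p p) (mem_extChartAt_target p) (by rw [hpp]; exact hp)
      obtain ⟨V, hV, hVd⟩ := hk.exists_mem_nhds_dimH_image_le (by
        have h1 : ∀ᶠ y in 𝓝 (extChartAt I p p), y ∈ (extChartAt I p).target :=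
          (isOpen_extChartAt_target p).eventually_mem (mem_extChartAt_target p)
        have h2 : ∀ᶠ y in 𝓝 (extChartAt I p p), f ((extChartAt I p).symm y) ∈
            (extChartAt I' q).source := by
          have h3 : ContinuousAt (f ∘ (extChartAt I p).symm) (extChartAt I p p) :=
            hf.continuous.continuousAt.comp (continuousAt_extChartAt_symm p)
          refine h3.eventually_mem ((isOpen_extChartAt_source q).mem_nhds ?_)
          rw [Function.comp_apply, hpp]
          exact hp
        filter_upwards [h1, h2] with y hy1 hy2
        rw [hrk y hy1 hy2, hrp])
      rw [hrp] at hVd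
      refine ⟨(extChartAt I p).source ∩ extChartAt I p ⁻¹' V, Filter.inter_mem
        (extChartAt_source_mem_nhds p) ((continuousAt_extChartAt p).preimage_mem_nhds hV),
        (dimH_mono ?_).trans hVd⟩
      rintro _ ⟨z, ⟨hz, hzV⟩, rfl⟩
      exact ⟨extChartAt I p z, hzV, by
        simp only [k, Function.comp_apply, (extChartAt I p).left_inv hz]⟩
    choose! V hV hVd using hloc
    -- Second countability enters here: a countable union has the supremum of the Hausdorff
    -- dimensions of its members.
    obtain ⟨t, ht, htc, hcov⟩ := TopologicalSpace.countable_cover_nhdsWithin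
      (fun p hp => mem_nhdsWithin_of_mem_nhds (hV p hp))
    have hsub : (extChartAt I' q).target ⊆ ⋃ p ∈ t, (extChartAt I' q ∘ f) '' V p := by
      intro y hy
      obtain ⟨z, hz⟩ := hs ((extChartAt I' q).symm y)
      have hzm : z ∈ f ⁻¹' (extChartAt I' q).source := by
        rw [Set.mem_preimage, hz]
        exact (extChartAt I' q).map_target hy
      obtain ⟨p, hpt, hzp⟩ := Set.mem_iUnion₂.1 (hcov hzm)
      refine Set.mem_iUnion₂.2 ⟨p, hpt, z, hzp, ?_⟩
      rw [Function.comp_apply, hz, (extChartAt I' q).right_inv hy]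
    have h1 : dimH (extChartAt I' q).target ≤ r := by
      refine (dimH_mono hsub).trans ?_
      rw [dimH_bUnion htc]
      exact iSup₂_le fun p hp => hVd p (ht hp)
    -- The chart target is a neighbourhood in `E'`, hence has full Hausdorff dimension.
    rw [Real.dimH_of_mem_nhds (extChartAt_target_mem_nhds q)] at h1
    exact_mod_cast h1
  have h := Submodule.eq_top_of_finrank_eq (le_antisymm (Submodule.finrank_le
    (LinearMap.range (modelDeriv I I' f x : E →ₗ[ℝ] E'))) (by rw [hr]; exact hrE))
  exact LinearMap.range_eq_top.1 h

end Rank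

/-! ### The orbit map and the existence of Cartan gauges -/

noncomputable section

namespace AtiyahPostLie

open Module Topology VectorField

variable {E : Type*} [NormedAddCommGroup E] [NormedSpace ℝ E]
  {B : Type*} [TopologicalSpace B] {I : ModelWithCorners ℝ E B}
  {G : Type*} [TopologicalSpace G] [ChartedSpace B G] [Group G] [LieGroup I ∞ G]

section Orbit

variable {E' : Type*} [NormedAddCommGroup E'] [NormedSpace ℝ E']
  {B' : Type*} [TopologicalSpace B'] {I' : ModelWithCorners ℝ E' B'}
  {M : Type*} [TopologicalSpace M] [ChartedSpace B' M] [IsManifold I' ∞ M]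
  [MulAction G M] [ContMDiffSMul I I' ∞ G M]

omit [LieGroup I ∞ G] [IsManifold I' ∞ M] in
variable (I I' G) in
theorem contMDiff_orbitMap (o : M) : ContMDiff I I' ∞ (fun g : G => g • o) :=
  contMDiff_id.smul contMDiff_const

theorem bijective_modelDeriv_mul_left (g a : G) :
    Function.Bijective (modelDeriv I I (fun b : G => g * b) a) := by
  have hd : ∀ k : G, MDifferentiable I I (fun b : G => k * b) := fun k =>
    (contMDiff_mul_left (I := I) (n := ∞) (a := k)).mdifferentiable (by simp)
  have h : ∀ k b : G, modelDeriv I I (fun b : G => k⁻¹ * b) (k * b) ∘L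
      modelDeriv I I (fun b : G => k * b) b = ContinuousLinearMap.id ℝ E := fun k b => by
    rw [← modelDeriv_comp b (hd _ _) (hd _ _)]
    have : (fun b : G => k⁻¹ * b) ∘ (fun b : G => k * b) = id := by ext; simp
    rw [this]
    exact mfderiv_id
  have h' := h g⁻¹ (g * a)
  rw [inv_inv, inv_mul_cancel_left] at h'
  exact Function.bijective_iff_has_inverse.2 ⟨_, DFunLike.congr_fun (h g a), DFunLike.congr_fun h'⟩

variable [I.Boundaryless] [I'.Boundaryless] [FiniteDimensional ℝ E] [FiniteDimensional ℝ E']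
  [SecondCountableTopology G] [MulAction.IsPretransitive G M]

variable (I I') in
theorem surjective_modelDeriv_orbitMap (o : M) (g : G) :
    Function.Surjective (modelDeriv I I' (fun g : G => g • o) g) := by
  have hπ := contMDiff_orbitMap I G I' o
  have hl : ∀ k : G, MDifferentiable I I (fun b : G => k * b) := fun k =>
    (contMDiff_mul_left (I := I) (n := ∞) (a := k)).mdifferentiable (by simp)
  have hs : ∀ k : G, MDifferentiable I' I' (fun u : M => k • u) := fun k =>
    (ContMDiffSMul.contMDiff_const_smul (I := I) (n := ∞) k).mdifferentiable (by simp)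
  have hinj : ∀ (k : G) (u : M), Function.Injective (modelDeriv I' I' (fun u : M => k • u) u) := by
    intro k u
    have h : modelDeriv I' I' (fun u : M => k⁻¹ • u) (k • u) ∘L
        modelDeriv I' I' (fun u : M => k • u) u = ContinuousLinearMap.id ℝ E' := by
      rw [← modelDeriv_comp u (hs _ _) (hs _ _)]
      have : (fun u : M => k⁻¹ • u) ∘ (fun u : M => k • u) = id := by ext; simp
      rw [this]
      exact mfderiv_id
    exact Function.LeftInverse.injective (DFunLike.congr_fun h)
  refine Function.Surjective.surjective_mfderiv_of_constant_rank
    (MulAction.surjective_smul G o) (hπ.of_le (by simp)) (fun k => ?_) g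
    (r := finrank ℝ (LinearMap.range (modelDeriv I I' (fun g : G => g • o) 1 : E →ₗ[ℝ] E')))
  -- Differentiating `(k * b) • o = k • (b • o)` at `b = 1`. Both translations are invertible, so
  -- the rank at `k` equals the rank at `1`.
  have h1 : modelDeriv I I' (fun g : G => g • o) (k * 1) ∘L modelDeriv I I (fun b : G => k * b) 1 =
      modelDeriv I' I' (fun u : M => k • u) ((1 : G) • o) ∘L
        modelDeriv I I' (fun g : G => g • o) 1 := by
    rw [← modelDeriv_comp (1 : G) (hs k _) (hπ.mdifferentiable (by simp) _),
      ← modelDeriv_comp (1 : G) (hπ.mdifferentiable (by simp) _) (hl k _)]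
    congr 1
    ext b
    exact mul_smul k b o
  rw [mul_one] at h1
  have h2 := ContinuousLinearMap.finrank_range_comp_comp (A := ContinuousLinearMap.id ℝ E')
    (modelDeriv I I' (fun g : G => g • o) k) Function.injective_id
    (bijective_modelDeriv_mul_left (I := I) k 1).2
  have h3 := ContinuousLinearMap.finrank_range_comp_comp (C := ContinuousLinearMap.id ℝ E)
    (modelDeriv I I' (fun g : G => g • o) 1) (hinj k ((1 : G) • o)) Function.surjective_id
  rw [ContinuousLinearMap.id_comp, h1] at h2
  rw [ContinuousLinearMap.comp_id] at h3
  exact h2.symm.trans h3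

variable (I I') in
/-- Every point of a homogeneous space lies in the domain of a Cartan gauge. -/
theorem exists_isCartanGauge (G : Type*) [TopologicalSpace G] [ChartedSpace B G] [Group G]
    [LieGroup I ∞ G] [SecondCountableTopology G] [MulAction G M] [ContMDiffSMul I I' ∞ G M]
    [MulAction.IsPretransitive G M] (o u : M) :
    ∃ (U : Set M) (σ : M → G), u ∈ U ∧ IsCartanGauge I I' o U σ := by
  obtain ⟨g, rfl⟩ := MulAction.exists_smul_eq G o u
  obtain ⟨U, σ, hU, hgU, hσ, h⟩ := (contMDiff_orbitMap I G I' o).exists_local_section (by simp)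
    (surjective_modelDeriv_orbitMap I I' o g)
  exact ⟨U, σ, hgU, hU, hσ, h⟩

end Orbit

end AtiyahPostLie

end

/-! ### Vector fields as derivations -/

section Derivation

open Topology VectorField

variable {E : Type*} [NormedAddCommGroup E] [NormedSpace ℝ E]
  {B : Type*} [TopologicalSpace B] {I : ModelWithCorners ℝ E B}
  {N : Type*} [TopologicalSpace N] [ChartedSpace B N]
  {F : Type*} [NormedAddCommGroup F] [NormedSpace ℝ F]

/-- The base point `y` is free up to a propositional equality, so that points such as `g * 1` or
`φ.symm (φ x)` can be simplified without transport between tangent spaces. -/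
theorem modelDeriv_comp_of_eq {E' : Type*} [NormedAddCommGroup E'] [NormedSpace ℝ E']
    {B' : Type*} [TopologicalSpace B'] {I' : ModelWithCorners ℝ E' B'}
    {M : Type*} [TopologicalSpace M] [ChartedSpace B' M]
    {E'' : Type*} [NormedAddCommGroup E''] [NormedSpace ℝ E'']
    {B'' : Type*} [TopologicalSpace B''] {I'' : ModelWithCorners ℝ E'' B''}
    {M' : Type*} [TopologicalSpace M'] [ChartedSpace B'' M'] {g : M → M'} {f : N → M} {x : N}
    {y : M} (hg : MDifferentiableAt I' I'' g y) (hf : MDifferentiableAt I I' f x) (h : f x = y) :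
    modelDeriv I I'' (g ∘ f) x = modelDeriv I' I'' g y ∘L modelDeriv I I' f x := by
  subst h
  exact modelDeriv_comp x hg hf

theorem modelDeriv_eq_fderiv {E' : Type*} [NormedAddCommGroup E'] [NormedSpace ℝ E'] (f : E → E')
    (x : E) : modelDeriv 𝓘(ℝ, E) 𝓘(ℝ, E') f x = fderiv ℝ f x :=
  mfderiv_eq_fderiv

theorem Filter.EventuallyEq.modelDeriv_eq {f g : N → F} {x : N} (h : f =ᶠ[𝓝 x] g) :
    modelDeriv I 𝓘(ℝ, F) f x = modelDeriv I 𝓘(ℝ, F) g x :=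
  h.mfderiv_eq

variable [I.Boundaryless] [IsManifold I 2 N] [CompleteSpace E]

/-- The Lie bracket of vector fields acts on functions as the commutator of the vector fields. -/
theorem modelDeriv_mlieBracket {z : N → F} {x : N} (hz : ContMDiff I 𝓘(ℝ, F) 2 z)
    {V W : Π p : N, TangentSpace I p}
    (hV : MDifferentiableAt I I.tangent (fun p => (V p : TangentBundle I N)) x)
    (hW : MDifferentiableAt I I.tangent (fun p => (W p : TangentBundle I N)) x) :
    modelDeriv I 𝓘(ℝ, F) z x (mlieBracket I V W x) =
      modelDeriv I 𝓘(ℝ, F) (fun p => modelDeriv I 𝓘(ℝ, F) z p (W p)) x (V x) -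
        modelDeriv I 𝓘(ℝ, F) (fun p => modelDeriv I 𝓘(ℝ, F) z p (V p)) x (W x) := by
  have : IsManifold I 1 N := IsManifold.of_le (n := 2) one_le_two
  set φ := extChartAt I x
  set y₀ := φ x
  have hy₀ : φ.symm y₀ = x := extChartAt_to_inv x
  have hyt : φ.target ∈ 𝓝 y₀ := extChartAt_target_mem_nhds x
  have hxs : φ.source ∈ 𝓝 x := extChartAt_source_mem_nhds x
  let A : E →L[ℝ] E := modelDeriv I 𝓘(ℝ, E) φ x
  have hφ : MDifferentiableAt I 𝓘(ℝ, E) φ x := mdifferentiableAt_extChartAt (mem_chart_source B x)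
  have hφs : ∀ y ∈ φ.target, MDifferentiableAt 𝓘(ℝ, E) I φ.symm y := fun y hy =>
    mdifferentiableAt_extChartAt_symm_of_boundaryless hy
  have hA : A.IsInvertible := isInvertible_mfderiv_extChartAt (mem_extChartAt_source x)
  have hAS : A ∘L modelDeriv 𝓘(ℝ, E) I φ.symm y₀ = ContinuousLinearMap.id ℝ E := by
    rw [← modelDeriv_comp_of_eq (y := x) hφ (hφs y₀ (mem_extChartAt_target x)) hy₀]
    refine (Filter.EventuallyEq.modelDeriv_eq (g := id) ?_).trans mfderiv_id
    filter_upwards [hyt] with y hy using φ.right_inv hy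
  let ζ : E → F := z ∘ φ.symm
  have hζ : ContDiffAt ℝ 2 ζ y₀ := by
    rw [← contMDiffAt_iff_contDiffAt]
    refine ContMDiffAt.comp (I' := I) y₀ hz.contMDiffAt
      ((contMDiffOn_extChartAt_symm (n := 2) x).contMDiffAt hyt)
  -- Each field is read in the chart as a map `X'` of the model space; the derivative of `z` along
  -- it becomes that of `ζ` along `X'`.
  have key : ∀ X : Π p : N, TangentSpace I p,
      MDifferentiableAt I I.tangent (fun p => (X p : TangentBundle I N)) x →
      ∃ X' : E → E, X' = mpullbackWithin 𝓘(ℝ, E) I φ.symm X (Set.range I) ∧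
        DifferentiableAt ℝ X' y₀ ∧ A (X x) = X' y₀ ∧
        (fun p => modelDeriv I 𝓘(ℝ, F) z p (X p)) =ᶠ[𝓝 x]
          (fun y => fderiv ℝ ζ y (X' y)) ∘ φ := by
    intro X hX
    let Xm : N → E := X
    let X' : E → E := mpullbackWithin 𝓘(ℝ, E) I φ.symm X (Set.range I)
    have hX' : ∀ y ∈ φ.target, modelDeriv 𝓘(ℝ, E) I φ.symm y (X' y) = Xm (φ.symm y) := by
      intro y hy
      have h1 := isInvertible_mfderivWithin_extChartAt_symm (I := I) hy
      have h2 : modelDeriv 𝓘(ℝ, E) I φ.symm y =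
          mfderivWithin 𝓘(ℝ, E) I φ.symm (Set.range I) y := by
        rw [I.range_eq_univ, mfderivWithin_univ]
        rfl
      rw [h2]
      exact h1.self_apply_inverse (X (φ.symm y))
    refine ⟨X', rfl, ?_, ?_, ?_⟩
    · have h1 := (mdifferentiableWithinAt_univ.2
        hX).differentiableWithinAt_mpullbackWithin_vectorField
      rw [Set.preimage_univ, Set.univ_inter] at h1
      have h2 : Set.range I ∈ 𝓝 y₀ := by simp [I.range_eq_univ]
      exact h1.differentiableAt h2
    · have h1 := hX' y₀ (mem_extChartAt_target x)
      rw [hy₀] at h1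
      have h2 := DFunLike.congr_fun hAS (X' y₀)
      rw [ContinuousLinearMap.comp_apply, h1] at h2
      exact h2
    · filter_upwards [hxs] with p hps
      have h2 := φ.map_source hps
      have h3 : φ.symm (φ p) = p := φ.left_inv hps
      have h4 : fderiv ℝ ζ (φ p) = modelDeriv I 𝓘(ℝ, F) z p ∘L
          modelDeriv 𝓘(ℝ, E) I φ.symm (φ p) := by
        rw [← modelDeriv_eq_fderiv]
        exact modelDeriv_comp_of_eq (hz.mdifferentiable two_ne_zero p) (hφs _ h2) h3
      have h5 := hX' _ h2
      rw [h3] at h5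
      rw [Function.comp_apply, h4, ContinuousLinearMap.comp_apply, h5]
  obtain ⟨V', hVd, hV', hAV, hVz⟩ := key V hV
  obtain ⟨W', hWd, hW', hAW, hWz⟩ := key W hW
  have hζ' : DifferentiableAt ℝ (fderiv ℝ ζ) y₀ :=
    (hζ.fderiv_right (m := 1) (by norm_num)).differentiableAt one_ne_zero
  have key2 : ∀ {X' : E → E}, DifferentiableAt ℝ X' y₀ → ∀ v : E,
      modelDeriv I 𝓘(ℝ, F) ((fun y => fderiv ℝ ζ y (X' y)) ∘ φ) x v =
        fderiv ℝ (fderiv ℝ ζ) y₀ (A v) (X' y₀) + fderiv ℝ ζ y₀ (fderiv ℝ X' y₀ (A v)) := by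
    intro X' hX' v
    have h1 := (hζ'.hasFDerivAt.clm_apply hX'.hasFDerivAt)
    rw [modelDeriv_comp x h1.differentiableAt.mdifferentiableAt hφ, modelDeriv_eq_fderiv, h1.fderiv]
    simp [A, y₀, add_comm]
  rw [hWz.modelDeriv_eq, hVz.modelDeriv_eq]
  have hzA : modelDeriv I 𝓘(ℝ, F) z x = fderiv ℝ ζ y₀ ∘L A := by
    rw [← modelDeriv_eq_fderiv, ← modelDeriv_comp x
      (hζ.differentiableAt two_ne_zero).mdifferentiableAt hφ]
    refine Filter.EventuallyEq.modelDeriv_eq ?_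
    filter_upwards [hxs] with p hp
    exact congrArg z (φ.left_inv hp).symm
  -- The bracket on the manifold is by definition the pullback of the bracket in the chart.
  have hbr : A (mlieBracket I V W x) = lieBracket ℝ V' W' y₀ := by
    have h1 : A (mlieBracket I V W x) = lieBracketWithin ℝ V' W'
        (φ.symm ⁻¹' Set.univ ∩ Set.range I) y₀ := by
      rw [hVd, hWd]
      exact hA.self_apply_inverse _
    rw [h1, I.range_eq_univ, Set.preimage_univ, Set.univ_inter, lieBracketWithin_univ]
  have hfin : ∀ b v w : E, A b = lieBracket ℝ V' W' y₀ → A v = V' y₀ → A w = W' y₀ →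
      modelDeriv I 𝓘(ℝ, F) z x b =
        modelDeriv I 𝓘(ℝ, F) ((fun y => fderiv ℝ ζ y (W' y)) ∘ φ) x v -
          modelDeriv I 𝓘(ℝ, F) ((fun y => fderiv ℝ ζ y (V' y)) ∘ φ) x w := by
    intro b v w hb hv hw
    -- By symmetry of the second derivative of `ζ` the second-order terms cancel, leaving `Dζ`
    -- applied to the bracket.
    rw [hzA, ContinuousLinearMap.comp_apply, key2 hW', key2 hV', hb, hv, hw, lieBracket, map_sub,
      (hζ.isSymmSndFDerivAt (by simp)) (V' y₀) (W' y₀)]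
    abel
  exact hfin _ _ _ hbr hAV hAW

end Derivation

noncomputable section

namespace AtiyahPostLie

open Module Topology VectorField

variable {E : Type*} [NormedAddCommGroup E] [NormedSpace ℝ E]
  {B : Type*} [TopologicalSpace B] {I : ModelWithCorners ℝ E B}
  {G : Type*} [TopologicalSpace G] [ChartedSpace B G] [Group G]
  {F : Type*} [NormedAddCommGroup F] [NormedSpace ℝ F]

/-! ### Derivatives along left-invariant vector fields -/

variable (I) in
/-- The derivative of `y` at `g` in the left trivialization of the tangent bundle. -/
def leftDeriv (y : G → F) (g : G) : E →L[ℝ] F :=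
  modelDeriv I 𝓘(ℝ, F) (fun a => y (g * a)) 1

/-- With a fixed base point the coordinate changes are trivial, so that `inTangentCoordinates` is
the derivative itself; this turns smoothness in bundle coordinates into smoothness of a map to a
space of linear maps. -/
theorem tangentBundleCore_coordChange_of_fixed {N : Type*} {M : Type*}
    [TopologicalSpace M] [ChartedSpace B M]
    [IsManifold I 1 M] {p : M} {g : N → M} (hg : ∀ x, g x = p) (x₀ x : N) :
    (tangentBundleCore I M).coordChange (achart B (g x)) (achart B (g x₀)) (g x) =
      ContinuousLinearMap.id ℝ E := by
  rw [hg, hg]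
  ext v
  exact (tangentBundleCore I M).coordChange_self _ _ (mem_chart_source B p) v

variable [LieGroup I ∞ G]

/-! ### Smooth dependence of derivatives on parameters -/

section Smooth

variable {E₁ : Type*} [NormedAddCommGroup E₁] [NormedSpace ℝ E₁]
  {B₁ : Type*} [TopologicalSpace B₁] {I₁ : ModelWithCorners ℝ E₁ B₁}
  {N : Type*} [TopologicalSpace N] [ChartedSpace B₁ N] [IsManifold I₁ ∞ N]
  {E₂ : Type*} [NormedAddCommGroup E₂] [NormedSpace ℝ E₂]
  {B₂ : Type*} [TopologicalSpace B₂] {I₂ : ModelWithCorners ℝ E₂ B₂}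
  {M : Type*} [TopologicalSpace M] [ChartedSpace B₂ M] [IsManifold I₂ ∞ M]
  {E₃ : Type*} [NormedAddCommGroup E₃] [NormedSpace ℝ E₃]
  {B₃ : Type*} [TopologicalSpace B₃] {I₃ : ModelWithCorners ℝ E₃ B₃}
  {P : Type*} [TopologicalSpace P] [ChartedSpace B₃ P] [IsManifold I₃ ∞ P]

/-- The derivatives at a fixed point of a smooth family of maps sending this point to a fixed point
form a smooth family. -/
theorem contMDiff_modelDeriv_of_fixed {f : N → M → P} {m : M} {p : P}
    (hf : ContMDiff (I₁.prod I₂) I₃ ∞ (Function.uncurry f)) (hp : ∀ x, f x m = p) :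
    ContMDiff I₁ 𝓘(ℝ, E₂ →L[ℝ] E₃) ∞ (fun x => modelDeriv I₂ I₃ (f x) m) := by
  intro x₀
  have h : ContMDiffAt I₁ 𝓘(ℝ, E₂ →L[ℝ] E₃) ∞ (inTangentCoordinates I₂ I₃ (fun _ : N => m)
      (fun x => f x m) (fun x => modelDeriv I₂ I₃ (f x) m) x₀) x₀ :=
    ContMDiffAt.mfderiv (n := ∞) f (fun _ : N => m) hf.contMDiffAt contMDiffAt_const (by simp)
  convert! h using 1
  ext1 x
  rw [inTangentCoordinates_eq _ _ _ (mem_chart_source B₂ m) (by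
    rw [hp x, hp x₀]
    exact mem_chart_source B₃ p),
    tangentBundleCore_coordChange_of_fixed (I := I₃) (g := fun x => f x m) hp x₀ x,
    tangentBundleCore_coordChange_of_fixed (I := I₂) (g := fun _ : N => m) (fun _ => rfl) x x₀]
  rfl

/-- The derivatives at a fixed point of a smooth family of vector-valued functions form a smooth
family. -/
theorem contMDiff_modelDeriv_family {f : N → M → F} {m : M}
    (hf : ContMDiff (I₁.prod I₂) 𝓘(ℝ, F) ∞ (Function.uncurry f)) :
    ContMDiff I₁ 𝓘(ℝ, E₂ →L[ℝ] F) ∞ (fun x => modelDeriv I₂ 𝓘(ℝ, F) (f x) m) := by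
  intro x₀
  have h : ContMDiffAt I₁ 𝓘(ℝ, E₂ →L[ℝ] F) ∞ (inTangentCoordinates I₂ 𝓘(ℝ, F) (fun _ : N => m)
      (fun x => f x m) (fun x => modelDeriv I₂ 𝓘(ℝ, F) (f x) m) x₀) x₀ :=
    ContMDiffAt.mfderiv (n := ∞) f (fun _ : N => m) hf.contMDiffAt contMDiffAt_const (by simp)
  convert! h using 1
  ext1 x
  rw [inTangentCoordinates_eq _ _ _ (mem_chart_source B₂ m) (Set.mem_univ _),
    tangentBundleCore_coordChange_of_fixed (I := I₂) (g := fun _ : N => m) (fun _ => rfl) x x₀]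
  simp only [tangentBundleCore_coordChange_model_space]
  rfl

end Smooth

theorem contMDiff_leftDeriv {y : G → F} (hy : ContMDiff I 𝓘(ℝ, F) ∞ y) :
    ContMDiff I 𝓘(ℝ, E →L[ℝ] F) ∞ (leftDeriv I y) :=
  contMDiff_modelDeriv_family (f := fun g a : G => y (g * a)) (hy.comp (contMDiff_mul I ∞))

theorem mdifferentiable_mul_left_smooth (g : G) : MDifferentiable I I (fun a : G => g * a) :=
  (contMDiff_mul_left (I := I) (n := ∞) (a := g)).mdifferentiable (by simp)

theorem leftDeriv_eq_comp {y : G → F} (hy : MDifferentiable I 𝓘(ℝ, F) y) (g : G) :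
    leftDeriv I y g = modelDeriv I 𝓘(ℝ, F) y g ∘L modelDeriv I I (fun a : G => g * a) 1 :=
  modelDeriv_comp_of_eq (hy g) (mdifferentiable_mul_left_smooth g 1) (mul_one g)

theorem leftDeriv_bilinear {F₁ F₂ : Type*} [NormedAddCommGroup F₁] [NormedSpace ℝ F₁]
    [NormedAddCommGroup F₂] [NormedSpace ℝ F₂] (β : F₁ →L[ℝ] F₂ →L[ℝ] F) {y : G → F₁} {z : G → F₂}
    (hy : MDifferentiable I 𝓘(ℝ, F₁) y) (hz : MDifferentiable I 𝓘(ℝ, F₂) z) (g : G) (v : E) :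
    leftDeriv I (fun g => β (y g) (z g)) g v =
      β (leftDeriv I y g v) (z g) + β (y g) (leftDeriv I z g v) := by
  have hβ : HasFDerivAt (fun p : F₁ × F₂ => β p.1 p.2)
      (β.isBoundedBilinearMap.deriv (y (g * 1), z (g * 1))) (y (g * 1), z (g * 1)) :=
    β.isBoundedBilinearMap.hasFDerivAt _
  have hl := mdifferentiable_mul_left_smooth (I := I) g 1
  have hy1 : MDifferentiableAt I 𝓘(ℝ, F₁) (fun a => y (g * a)) 1 := (hy (g * 1)).comp 1 hl
  have hz1 : MDifferentiableAt I 𝓘(ℝ, F₂) (fun a => z (g * a)) 1 := (hz (g * 1)).comp 1 hl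
  have hyz : HasMFDerivAt I 𝓘(ℝ, F₁ × F₂) (fun a => (y (g * a), z (g * a))) (1 : G)
      ((leftDeriv I y g).prod (leftDeriv I z g)) :=
    ⟨hy1.continuousAt.prodMk hz1.continuousAt, hy1.hasMFDerivAt.2.prodMk hz1.hasMFDerivAt.2⟩
  have h := HasMFDerivAt.comp (I' := 𝓘(ℝ, F₁ × F₂)) (1 : G) hβ.hasMFDerivAt hyz
  have h' : leftDeriv I (fun g => β (y g) (z g)) g =
    (β.isBoundedBilinearMap.deriv (y (g * 1), z (g * 1))) ∘L
      ((leftDeriv I y g).prod (leftDeriv I z g)) := h.mfderiv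
  rw [h', mul_one, ContinuousLinearMap.comp_apply, ContinuousLinearMap.prod_apply]
  exact add_comm _ _

theorem leftDeriv_clm_apply {A : G → E →L[ℝ] F} {x : G → E}
    (hA : MDifferentiable I 𝓘(ℝ, E →L[ℝ] F) A) (hx : MDifferentiable I 𝓘(ℝ, E) x) (g : G) (v : E) :
    leftDeriv I (fun g => A g (x g)) g v = leftDeriv I A g v (x g) + A g (leftDeriv I x g v) :=
  leftDeriv_bilinear (ContinuousLinearMap.id ℝ (E →L[ℝ] F)) hA hx g v

omit [LieGroup I ∞ G] in
theorem leftDeriv_const (c : F) (g : G) : leftDeriv I (fun _ : G => c) g = 0 :=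
  mfderiv_const

theorem leftDeriv_add {y z : G → F} (hy : MDifferentiable I 𝓘(ℝ, F) y)
    (hz : MDifferentiable I 𝓘(ℝ, F) z) (g : G) :
    leftDeriv I (fun g => y g + z g) g = leftDeriv I y g + leftDeriv I z g := by
  have hl := mdifferentiable_mul_left_smooth (I := I) g 1
  have hy1 : MDifferentiableAt I 𝓘(ℝ, F) (fun a => y (g * a)) 1 := (hy (g * 1)).comp 1 hl
  have hz1 : MDifferentiableAt I 𝓘(ℝ, F) (fun a => z (g * a)) 1 := (hz (g * 1)).comp 1 hl
  exact mfderiv_add hy1 hz1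

theorem leftDeriv_clm_comp {F₁ : Type*} [NormedAddCommGroup F₁] [NormedSpace ℝ F₁] (L : F →L[ℝ] F₁)
    {y : G → F} (hy : MDifferentiable I 𝓘(ℝ, F) y) (g : G) :
    leftDeriv I (fun g => L (y g)) g = L ∘L leftDeriv I y g := by
  have hy1 : MDifferentiableAt I 𝓘(ℝ, F) (fun a => y (g * a)) 1 :=
    (hy (g * 1)).comp 1 (mdifferentiable_mul_left_smooth (I := I) g 1)
  have h := modelDeriv_comp (I'' := 𝓘(ℝ, F₁)) (1 : G) L.differentiableAt.mdifferentiableAt hy1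
  rw [modelDeriv_eq_fderiv, L.fderiv] at h
  exact h

/-- The regularity class in which the Lie algebra structure on the tangent space at `1` is
available. -/
instance : LieGroup I (minSmoothness ℝ 3) G := LieGroup.of_le (n := ∞) (by
  rw [minSmoothness_of_isRCLikeNormedField]
  exact ENat.LEInfty.out)

/-- `leftDeriv I z · v` is the derivative of `z` along the left-invariant field of `v`. The left
side is thus the commutator of two such fields applied to `z`, and the bracket of these fields is
the left-invariant field of `⁅v, w⁆`. -/
theorem leftDeriv_leftDeriv_sub [I.Boundaryless] [CompleteSpace E] {z : G → F}
    (hz : ContMDiff I 𝓘(ℝ, F) ∞ z) (g : G) (v w : GroupLieAlgebra I G) :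
    leftDeriv I (leftDeriv I z) g v w - leftDeriv I (leftDeriv I z) g w v =
      leftDeriv I z g (⁅v, w⁆ : GroupLieAlgebra I G) := by
  have hz1 : MDifferentiable I 𝓘(ℝ, F) z := hz.mdifferentiable (by simp)
  have hz2 : MDifferentiable I 𝓘(ℝ, E →L[ℝ] F) (leftDeriv I z) :=
    (contMDiff_leftDeriv hz).mdifferentiable (by simp)
  have h0 : ∀ (f : G → F), MDifferentiable I 𝓘(ℝ, F) f → ∀ (u : GroupLieAlgebra I G) (a : G),
      modelDeriv I 𝓘(ℝ, F) f a (mulInvariantVectorField u a) = leftDeriv I f a u := by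
    intro f hf u a
    rw [leftDeriv_eq_comp hf]
    rfl
  have h1 : ∀ u : GroupLieAlgebra I G,
      (fun p => modelDeriv I 𝓘(ℝ, F) z p (mulInvariantVectorField u p)) =
        fun p => leftDeriv I z p u := fun u => funext fun p => h0 z hz1 u p
  -- With the inner direction `u` frozen, the Leibniz rule leaves only the second derivative; its
  -- first argument is the direction differentiated last.
  have h2 : ∀ u u' : E,
      leftDeriv I (fun p => leftDeriv I z p u) g u' = leftDeriv I (leftDeriv I z) g u' u := by
    intro u u'
    rw [leftDeriv_clm_apply hz2 (fun _ => mdifferentiableAt_const), leftDeriv_const]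
    simp
  have h3 : ∀ u : E, MDifferentiable I 𝓘(ℝ, F) (fun p => leftDeriv I z p u) := fun u p =>
    (hz2 p).clm_apply mdifferentiableAt_const
  have h := modelDeriv_mlieBracket (x := g) (hz.of_le ENat.LEInfty.out)
    (mdifferentiableAt_mulInvariantVectorField v) (mdifferentiableAt_mulInvariantVectorField w)
  rw [h1, h1] at h
  have h4 := (congrArg (modelDeriv I 𝓘(ℝ, F) z g)
    (congrFun (mulInvariantVector_mlieBracket v w) g)).symm.trans (h0 z hz1 _ g)
  refine Eq.trans (congrArg₂ (· - ·) ?_ ?_) (h.symm.trans h4)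
  · exact (h2 w v).symm.trans (h0 _ (h3 w) v g).symm
  · exact (h2 v w).symm.trans (h0 _ (h3 v) w g).symm

/-! ### The adjoint representation -/

variable (I) in
/-- The adjoint representation, as a family of continuous linear maps of the model space. -/
def AdCLM (g : G) : E →L[ℝ] E := modelDeriv I I (fun a : G => g * a * g⁻¹) 1

theorem contMDiff_AdCLM : ContMDiff I 𝓘(ℝ, E →L[ℝ] E) ∞ (AdCLM I : G → E →L[ℝ] E) := by
  refine contMDiff_modelDeriv_of_fixed (f := fun g a : G => g * a * g⁻¹) (p := 1) ?_ (by simp)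
  exact (contMDiff_fst.mul contMDiff_snd).mul contMDiff_fst.inv

theorem mdifferentiable_conj (g : G) : MDifferentiable I I (fun a : G => g * a * g⁻¹) :=
  ((contMDiff_mul_right (I := I) (n := ∞) (a := g⁻¹)).comp
    (contMDiff_mul_left (I := I) (n := ∞) (a := g))).mdifferentiable (by simp)

theorem isInvertible_mfderiv_conj (g a : G) :
    (mfderiv I I (fun a : G => g * a * g⁻¹) a).IsInvertible := by
  have h : ∀ k b : G, modelDeriv I I (fun b : G => k⁻¹ * b * k⁻¹⁻¹) (k * b * k⁻¹) ∘L
      modelDeriv I I (fun b : G => k * b * k⁻¹) b = ContinuousLinearMap.id ℝ E := fun k b => by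
    rw [← modelDeriv_comp b (mdifferentiable_conj _ _) (mdifferentiable_conj _ _)]
    have : (fun b : G => k⁻¹ * b * k⁻¹⁻¹) ∘ (fun b : G => k * b * k⁻¹) = id := by
      ext b
      simp [mul_assoc]
    rw [this]
    exact mfderiv_id
  have h' := h g⁻¹ (g * a * g⁻¹)
  have h2 : g⁻¹ * (g * a * g⁻¹) * g⁻¹⁻¹ = a := by simp [mul_assoc]
  rw [h2] at h'
  simp only [inv_inv] at h'
  have h3 := h g a
  rw [inv_inv] at h3
  exact ContinuousLinearMap.IsInvertible.of_inverse h' h3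

/-- Conjugation is a group homomorphism, so it intertwines left translation by `a` with left
translation by `g * a * g⁻¹`; differentiating at `1` relates the two left-invariant fields. -/
theorem mpullback_conj_mulInvariantVectorField (g : G) (v : GroupLieAlgebra I G) :
    mpullback I I (fun a : G => g * a * g⁻¹) (mulInvariantVectorField (Ad g v)) =
      mulInvariantVectorField v := by
  ext1 a
  have h1 : modelDeriv I I (fun b : G => g * a * g⁻¹ * b) 1 ∘L AdCLM I g =
      modelDeriv I I (fun a : G => g * a * g⁻¹) a ∘L modelDeriv I I (fun b : G => a * b) 1 := by
    rw [AdCLM, ← modelDeriv_comp_of_eq (mdifferentiable_mul_left_smooth _ _)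
      (mdifferentiable_conj g 1) (by simp), ← modelDeriv_comp_of_eq (mdifferentiable_conj g a)
      (mdifferentiable_mul_left_smooth _ _) (mul_one a)]
    congr 1
    ext b
    simp [mul_assoc]
  have h2 : (mulInvariantVectorField (Ad g v) (g * a * g⁻¹) : TangentSpace I (g * a * g⁻¹)) =
      mfderiv I I (fun a : G => g * a * g⁻¹) a (mulInvariantVectorField v a) :=
    DFunLike.congr_fun h1 v
  rw [mpullback_apply, h2]
  exact (isInvertible_mfderiv_conj g a).inverse_apply_self _

omit [LieGroup I ∞ G] in
theorem mulInvariantVectorField_one (v : GroupLieAlgebra I G) :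
    mulInvariantVectorField v (1 : G) = v := by
  have h : (fun a : G => (1 : G) * a) = id := by
    ext a
    exact one_mul a
  unfold mulInvariantVectorField
  rw [h, mfderiv_id]
  rfl

/-- The adjoint representation acts by Lie algebra homomorphisms. -/
theorem Ad_bracket [CompleteSpace E] (g : G) (v w : GroupLieAlgebra I G) :
    Ad g ⁅v, w⁆ = ⁅Ad g v, Ad g w⁆ := by
  -- Pullback by conjugation commutes with the bracket of vector fields; evaluation at `1` gives the
  -- identity in the Lie algebra.
  have h := mpullback_mlieBracket (f := fun a : G => g * a * g⁻¹) (x₀ := 1) (n := ∞)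
    (mdifferentiableAt_mulInvariantVectorField (Ad g v))
    (mdifferentiableAt_mulInvariantVectorField (Ad g w))
    ((contMDiff_mul_right (I := I) (n := ∞) (a := g⁻¹)).comp
      (contMDiff_mul_left (I := I) (n := ∞) (a := g))).contMDiffAt (by
      rw [minSmoothness_of_isRCLikeNormedField]
      exact ENat.LEInfty.out)
  rw [mpullback_conj_mulInvariantVectorField, mpullback_conj_mulInvariantVectorField,
    ← mulInvariantVector_mlieBracket (Ad g v), ← GroupLieAlgebra.bracket_def,
    ← GroupLieAlgebra.bracket_def] at h
  -- Written as a value of `Ad g`, the bracket has a left-invariant field whose pullback is known.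
  have h1 : ⁅Ad g v, Ad g w⁆ = Ad g (Ad g⁻¹ ⁅Ad g v, Ad g w⁆) := by
    rw [← Ad_mul, mul_inv_cancel, Ad_one]
  rw [h1, mpullback_conj_mulInvariantVectorField, mulInvariantVectorField_one] at h
  rw [← h, ← h1]

end AtiyahPostLie

end

/-! ### The post-Lie algebra of equivariant functions -/

theorem IsPostLie.transport {k A A' : Type*} [Field k] [AddCommGroup A] [Module k A]
    [AddCommGroup A'] [Module k A'] {br tr : A → A → A} (h : IsPostLie k br tr) (e : A ≃ₗ[k] A') :
    IsPostLie k (fun x y => e (br (e.symm x) (e.symm y)))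
      (fun x y => e (tr (e.symm x) (e.symm y))) where
  lie :=
    { add_left := fun x y z => by rw [map_add, h.lie.add_left, map_add]
      smul_left := fun c x y => by rw [map_smul, h.lie.smul_left, map_smul]
      add_right := fun x y z => by rw [map_add, h.lie.add_right, map_add]
      smul_right := fun c x y => by rw [map_smul, h.lie.smul_right, map_smul]
      self := fun x => by rw [h.lie.self, map_zero]
      jacobi := fun x y z => by
        simp only [LinearEquiv.symm_apply_apply]
        rw [← map_add, ← map_add, h.lie.jacobi, map_zero] }
  add_left x y z := by rw [map_add, h.add_left, map_add]
  smul_left c x y := by rw [map_smul, h.smul_left, map_smul]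
  add_right x y z := by rw [map_add, h.add_right, map_add]
  smul_right c x y := by rw [map_smul, h.smul_right, map_smul]
  derivation x y z := by
    simp only [LinearEquiv.symm_apply_apply]
    rw [h.derivation, map_add]
  bracket_tr x y z := by
    simp only [productAssociator, LinearEquiv.symm_apply_apply]
    rw [h.bracket_tr, productAssociator, productAssociator, map_sub, map_sub, map_sub]

noncomputable section

namespace AtiyahPostLie

open Module Topology VectorField

variable {E : Type*} [NormedAddCommGroup E] [NormedSpace ℝ E]
  {B : Type*} [TopologicalSpace B] {I : ModelWithCorners ℝ E B}
  {G : Type*} [TopologicalSpace G] [ChartedSpace B G] [Group G] [LieGroup I ∞ G]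

/-- The chain rule for left translation. It makes the product pointwise linear in `x`, and the
identities below are computed in this form. -/
theorem triangle_eq_leftDeriv {y : G → E} (hy : ContMDiff I 𝓘(ℝ, E) ∞ y)
    (x : G → E) (g : G) : (triangle (I := I) x y g : E) = leftDeriv I y g (x g) := by
  rw [leftDeriv_eq_comp (hy.mdifferentiable (by simp))]
  rfl

theorem contMDiff_triangle {x y : G → E} (hx : ContMDiff I 𝓘(ℝ, E) ∞ x)
    (hy : ContMDiff I 𝓘(ℝ, E) ∞ y) :
    ContMDiff I 𝓘(ℝ, E) ∞ (M' := E) (triangle (I := I) x y) := by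
  have h : (triangle (I := I) x y : G → E) = fun g => leftDeriv I y g (x g) :=
    funext fun g => triangle_eq_leftDeriv hy x g
  rw [h]
  exact (contMDiff_leftDeriv hy).clm_apply hx

/-- The derivatives of an equivariant function are equivariant. -/
theorem leftDeriv_comp_Ad {y : G → E} (hy : ContMDiff I 𝓘(ℝ, E) ∞ y) {h : G}
    (hyh : ∀ g, y (g * h) = AdCLM I h⁻¹ (y g)) (g : G) :
    leftDeriv I y (g * h) ∘L AdCLM I h⁻¹ = AdCLM I h⁻¹ ∘L leftDeriv I y g := by
  have hy' : MDifferentiable I 𝓘(ℝ, E) y := hy.mdifferentiable (by simp)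
  have h1 : MDifferentiableAt I 𝓘(ℝ, E) (fun a => y (g * h * a)) 1 :=
    (hy' _).comp 1 (mdifferentiable_mul_left_smooth (I := I) (g * h) 1)
  -- Both sides are the derivative at `a = 1` of `y (g * a * h)`, since `g * h * (h⁻¹ * a * h) = g *
  -- a * h` and `y (g * a * h) = Ad h⁻¹ (y (g * a))`.
  rw [← leftDeriv_clm_comp _ hy', AdCLM, leftDeriv, leftDeriv,
    ← modelDeriv_comp_of_eq h1 (mdifferentiable_conj h⁻¹ 1) (by simp)]
  congr 1
  ext1 a
  rw [← AdCLM, ← hyh]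
  simp [mul_assoc]

theorem triangle_mem_equivariantFunctions {H : Subgroup G} {x y : G → GroupLieAlgebra I G}
    (hx : x ∈ equivariantFunctions I H) (hy : y ∈ equivariantFunctions I H) :
    triangle x y ∈ equivariantFunctions I H := by
  refine ⟨contMDiff_triangle hx.1 hy.1, fun g h hh => ?_⟩
  have h1 := DFunLike.congr_fun
    (leftDeriv_comp_Ad (E := E) (y := y) hy.1 (fun g => hy.2 g h hh) g) (x g : E)
  refine (triangle_eq_leftDeriv (E := E) (y := y) hy.1 x (g * h)).trans ?_
  refine Eq.trans ?_ (h1.trans (congrArg (AdCLM I h⁻¹)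
    (triangle_eq_leftDeriv (E := E) (y := y) hy.1 x g).symm))
  exact congrArg (leftDeriv (F := E) I y (g * h)) (hx.2 g h hh)

/-! ### The post-Lie identities -/

section Bracket

variable [FiniteDimensional ℝ E] [CompleteSpace E]

variable (I G) in
/-- The bracket of the Lie algebra, as a bilinear map of the model space. -/
def bracketLM : E →ₗ[ℝ] E →ₗ[ℝ] E :=
  (LinearMap.mk₂ ℝ (fun v w : GroupLieAlgebra I G => ⁅v, w⁆) add_lie smul_lie lie_add
    (fun c v w => lie_smul c v w) :
      GroupLieAlgebra I G →ₗ[ℝ] GroupLieAlgebra I G →ₗ[ℝ] GroupLieAlgebra I G)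

variable (I G) in
/-- The bracket of the Lie algebra, as a continuous bilinear map of the model space. -/
def bracketCLM : E →L[ℝ] E →L[ℝ] E :=
  LinearMap.toContinuousLinearMap
    ((LinearMap.toContinuousLinearMap : (E →ₗ[ℝ] E) ≃ₗ[ℝ] E →L[ℝ] E) ∘ₗ bracketLM I G)

theorem bracket_mem_equivariantFunctions {H : Subgroup G} {x y : G → GroupLieAlgebra I G}
    (hx : x ∈ equivariantFunctions I H) (hy : y ∈ equivariantFunctions I H) :
    bracket x y ∈ equivariantFunctions I H := by
  refine ⟨?_, fun g h hh => ?_⟩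
  · have hx1 : ContMDiff I 𝓘(ℝ, E) ∞ (M' := E) x := hx.1
    have hy1 : ContMDiff I 𝓘(ℝ, E) ∞ (M' := E) y := hy.1
    exact ((bracketCLM I G).contDiff.contMDiff.comp hx1).clm_apply hy1
  · rw [bracket, hx.2 g h hh, hy.2 g h hh, bracket, Ad_bracket]

omit [FiniteDimensional ℝ E] [CompleteSpace E] in
theorem triangle_add_right {y z : G → E} (hy : ContMDiff I 𝓘(ℝ, E) ∞ y)
    (hz : ContMDiff I 𝓘(ℝ, E) ∞ z) (x : G → E) (g : G) :
    (triangle (I := I) x (fun g => y g + z g) g : E) =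
      triangle (I := I) x y g + triangle (I := I) x z g := by
  have h1 := triangle_eq_leftDeriv (E := E) (I := I) (y := fun g => y g + z g) (hy.add hz) x g
  rw [leftDeriv_add (hy.mdifferentiable (by simp)) (hz.mdifferentiable (by simp))] at h1
  exact h1.trans (congrArg₂ (· + ·) (triangle_eq_leftDeriv hy x g).symm
    (triangle_eq_leftDeriv hz x g).symm)

omit [FiniteDimensional ℝ E] [CompleteSpace E] in
theorem triangle_smul_right {y : G → E} (hy : ContMDiff I 𝓘(ℝ, E) ∞ y) (c : ℝ)
    (x : G → E) (g : G) :
    (triangle (I := I) x (fun g => c • y g) g : E) = c • (triangle (I := I) x y g : E) := by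
  let L : E →L[ℝ] E := c • ContinuousLinearMap.id ℝ E
  have h1 := triangle_eq_leftDeriv (E := E) (I := I) (y := fun g => L (y g))
    (L.contDiff.contMDiff.comp hy) x g
  rw [leftDeriv_clm_comp _ (hy.mdifferentiable (by simp))] at h1
  exact h1.trans (congrArg (c • ·) (triangle_eq_leftDeriv hy x g).symm)

/-- The Leibniz rule, the pointwise bracket being one bilinear map that does not vary with `g`. -/
theorem triangle_bracket {y z : G → E} (hy : ContMDiff I 𝓘(ℝ, E) ∞ y)
    (hz : ContMDiff I 𝓘(ℝ, E) ∞ z) (x : G → E) (g : G) :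
    (triangle (I := I) x (bracket (I := I) y z) g : E) =
      bracketCLM I G (triangle (I := I) x y g) (z g) +
        bracketCLM I G (y g) (triangle (I := I) x z g) := by
  have h0 : ContMDiff I 𝓘(ℝ, E) ∞ (fun g => bracketCLM I G (y g) (z g)) :=
    ((bracketCLM I G).contDiff.contMDiff.comp hy).clm_apply hz
  have h1 := triangle_eq_leftDeriv h0 x g
  rw [leftDeriv_bilinear (bracketCLM I G) (hy.mdifferentiable (by simp))
    (hz.mdifferentiable (by simp))] at h1
  exact h1.trans (congrArg₂ (fun u v : E => bracketCLM I G u (z g) + bracketCLM I G (y g) v)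
    (triangle_eq_leftDeriv hy x g).symm (triangle_eq_leftDeriv hz x g).symm)

omit [FiniteDimensional ℝ E] [CompleteSpace E] in
-- Differentiating `leftDeriv I z g (y g)` gives a second-derivative term and a term in the
-- derivative of `y`; the latter is exactly `(x ▷ y) ▷ z`.
theorem triangle_associator {x y z : G → E} (hy : ContMDiff I 𝓘(ℝ, E) ∞ y)
    (hz : ContMDiff I 𝓘(ℝ, E) ∞ z) (g : G) :
    (triangle (I := I) x (triangle (I := I) y z) g : E) -
        triangle (I := I) (triangle (I := I) x y) z g =
      leftDeriv I (leftDeriv I z) g (x g) (y g) := by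
  have hz2 := contMDiff_leftDeriv hz
  have h0 : (triangle (I := I) y z : G → E) = fun g => leftDeriv I z g (y g) :=
    funext fun g => triangle_eq_leftDeriv hz y g
  have h1 : (triangle (I := I) x (triangle (I := I) y z) g : E) =
      leftDeriv I (leftDeriv I z) g (x g) (y g) + leftDeriv I z g (leftDeriv I y g (x g)) := by
    rw [h0, ← leftDeriv_clm_apply (hz2.mdifferentiable (by simp)) (hy.mdifferentiable (by simp))]
    exact triangle_eq_leftDeriv (hz2.clm_apply hy) x g
  have h2 : (triangle (I := I) (triangle (I := I) x y) z g : E) =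
      leftDeriv I z g (leftDeriv I y g (x g)) :=
    (triangle_eq_leftDeriv hz _ g).trans
      (congrArg (leftDeriv I z g) (triangle_eq_leftDeriv hy x g))
  exact (congrArg₂ (fun u v : E => u - v) h1 h2).trans (add_sub_cancel_right _ _)

omit [FiniteDimensional ℝ E] in
theorem triangle_bracket_left [I.Boundaryless] {x y z : G → E} (hx : ContMDiff I 𝓘(ℝ, E) ∞ x)
    (hy : ContMDiff I 𝓘(ℝ, E) ∞ y) (hz : ContMDiff I 𝓘(ℝ, E) ∞ z) (g : G) :
    (triangle (I := I) (bracket (I := I) x y) z g : E) =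
      ((triangle (I := I) x (triangle (I := I) y z) g : E) -
        triangle (I := I) (triangle (I := I) x y) z g) -
      ((triangle (I := I) y (triangle (I := I) x z) g : E) -
        triangle (I := I) (triangle (I := I) y x) z g) :=
  (triangle_eq_leftDeriv hz _ g).trans ((leftDeriv_leftDeriv_sub hz g (x g) (y g)).symm.trans
    (congrArg₂ (· - ·) (triangle_associator hy hz g).symm (triangle_associator hx hz g).symm))

theorem isPostLie_equivariantFunctions [I.Boundaryless] (H : Subgroup G) :
    IsPostLie ℝ (A := equivariantFunctions I H)
      (fun x y => ⟨bracket x.1 y.1, bracket_mem_equivariantFunctions x.2 y.2⟩)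
      (fun x y => ⟨triangle x.1 y.1, triangle_mem_equivariantFunctions x.2 y.2⟩) where
  lie :=
    { add_left := fun x y z => Subtype.ext (funext fun g => add_lie (x.1 g) (y.1 g) (z.1 g))
      smul_left := fun c x y => Subtype.ext (funext fun g => smul_lie c (x.1 g) (y.1 g))
      add_right := fun x y z => Subtype.ext (funext fun g => lie_add (x.1 g) (y.1 g) (z.1 g))
      smul_right := fun c x y => Subtype.ext (funext fun g => lie_smul c (x.1 g) (y.1 g))
      self := fun x => Subtype.ext (funext fun g => lie_self (x.1 g))
      jacobi := fun x y z => Subtype.ext (funext fun g => by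
        change ⁅⁅x.1 g, y.1 g⁆, z.1 g⁆ + ⁅⁅y.1 g, z.1 g⁆, x.1 g⁆ + ⁅⁅z.1 g, x.1 g⁆, y.1 g⁆ = 0
        rw [← lie_skew ⁅x.1 g, y.1 g⁆, ← lie_skew ⁅y.1 g, z.1 g⁆, ← lie_skew ⁅z.1 g, x.1 g⁆,
          ← neg_add, ← neg_add, neg_eq_zero, ← lie_jacobi (x.1 g) (y.1 g) (z.1 g)]
        abel) }
  add_left x y z := Subtype.ext (funext fun g => by
    have h := fun v : G → E => triangle_eq_leftDeriv (E := E) (I := I) (y := z.1) z.2.1 v g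
    exact (h _).trans ((map_add (leftDeriv (F := E) I z.1 g) (x.1 g : E) (y.1 g : E)).trans
      (congrArg₂ (fun u v : E => u + v) (h x.1).symm (h y.1).symm)))
  smul_left c x y := Subtype.ext (funext fun g => by
    have h := fun v : G → E => triangle_eq_leftDeriv (E := E) (I := I) (y := y.1) y.2.1 v g
    exact (h _).trans ((map_smul (leftDeriv (F := E) I y.1 g) c (x.1 g : E)).trans
      (congrArg (fun u : E => c • u) (h x.1).symm)))
  add_right x y z := Subtype.ext (funext fun g =>
    triangle_add_right (E := E) (y := y.1) (z := z.1) y.2.1 z.2.1 x.1 g)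
  smul_right c x y := Subtype.ext (funext fun g =>
    triangle_smul_right (E := E) (y := y.1) y.2.1 c x.1 g)
  derivation x y z := Subtype.ext (funext fun g =>
    triangle_bracket (E := E) (y := y.1) (z := z.1) y.2.1 z.2.1 x.1 g)
  bracket_tr x y z := Subtype.ext (funext fun g =>
    triangle_bracket_left (E := E) (x := x.1) (y := y.1) (z := z.1) x.2.1 y.2.1 z.2.1 g)

end Bracket

end AtiyahPostLie

end

noncomputable section

namespace AtiyahPostLie

open Module Topology

variable {E : Type*} [NormedAddCommGroup E] [NormedSpace ℝ E]
  {B : Type*} [TopologicalSpace B] {I : ModelWithCorners ℝ E B}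
  {G : Type*} [TopologicalSpace G] [ChartedSpace B G] [Group G] [LieGroup I ∞ G]
  {E' : Type*} [NormedAddCommGroup E'] [NormedSpace ℝ E']
  {B' : Type*} [TopologicalSpace B'] {I' : ModelWithCorners ℝ E' B'}
  {M : Type*} [TopologicalSpace M] [ChartedSpace B' M]
  [MulAction G M]

/-! ### Equivariant functions and sections of the Atiyah bundle -/

omit [TopologicalSpace M] in
-- The element of the isotropy group relating the two representatives can only be `g⁻¹ * k`.
theorem AtiyahFiber.mk_eq_mk_iff {o u : M} {g k : G} (hg : g • o = u) (hk : k • o = u)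
    (v w : GroupLieAlgebra I G) :
    AtiyahFiber.mk g hg v = AtiyahFiber.mk k hk w ↔ w = Ad (g⁻¹ * k)⁻¹ v := by
  refine Subtype.ext_iff.trans (AtiyahBundle.mk_eq_iff.trans ⟨?_, fun h => ?_⟩)
  · rintro ⟨h, -, rfl, h2⟩
    rw [h2, inv_mul_cancel_left]
  · refine ⟨g⁻¹ * k, ?_, by group, h⟩
    rw [MulAction.mem_stabilizer_iff, mul_smul, hk, ← hg, inv_smul_smul]

omit [TopologicalSpace M] in
theorem AtiyahFiber.mk_equivariant {o : M} {x : G → GroupLieAlgebra I G}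
    (hx : x ∈ equivariantFunctions I (MulAction.stabilizer G o)) {g k : G} {u : M}
    (hg : g • o = u) (hk : k • o = u) :
    AtiyahFiber.mk g hg (x g) = AtiyahFiber.mk k hk (x k) := by
  rw [AtiyahFiber.mk_eq_mk_iff, ← hx.2 g (g⁻¹ * k), mul_inv_cancel_left]
  rw [MulAction.mem_stabilizer_iff, mul_smul, hk, ← hg, inv_smul_smul]

variable [MulAction.IsPretransitive G M]

variable (I') in
/-- The section of the Atiyah bundle given by an equivariant function. -/
def sectionOfEquivariant (o : M) :
    equivariantFunctions (G := G) I (MulAction.stabilizer G o) →ₗ[ℝ] smoothSections I G I' o where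
  toFun x := ⟨fun u => AtiyahFiber.mk (MulAction.exists_smul_eq G o u).choose
      (MulAction.exists_smul_eq G o u).choose_spec (x.1 _), fun _ σ hσ =>
    -- The local form in a gauge `σ` is `x ∘ σ`; equivariance makes the arbitrary choice of
    -- representative over `u` irrelevant.
    ⟨fun u => x.1 (σ u), ContMDiff.comp_contMDiffOn (I' := I) (E'' := E) (I'' := 𝓘(ℝ, E)) x.2.1
      hσ.smooth, fun _ hu _ => AtiyahFiber.mk_equivariant x.2 _ hu⟩⟩
  map_add' _ _ := Subtype.ext (funext fun _ => AtiyahFiber.mk_add _ _ _ _)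
  map_smul' _ _ := Subtype.ext (funext fun _ => AtiyahFiber.mk_smul _ _ _ _)

theorem sectionOfEquivariant_apply {o : M}
    (x : equivariantFunctions (G := G) I (MulAction.stabilizer G o)) (g : G) (u : M)
    (hu : g • o = u) : (sectionOfEquivariant I' o x).1 u = AtiyahFiber.mk g hu (x.1 g) :=
  AtiyahFiber.mk_equivariant x.2 _ hu

theorem sectionOfEquivariant_injective (o : M) :
    Function.Injective (sectionOfEquivariant (I := I) (G := G) I' o) := by
  intro x y hxy
  refine Subtype.ext (funext fun g => (AtiyahFiber.mk_bijective g (rfl : g • o = g • o)).1 ?_)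
  rw [← sectionOfEquivariant_apply (I' := I'), ← sectionOfEquivariant_apply (I' := I'), hxy]

/-- Since `v ↦ [(g, v)]` is a bijection onto the fibre over `g • o`, a section determines `x g` for
every `g`. Equivariance is automatic; smoothness near a given `g₀` is read off in a gauge around `g₀
• o`. -/
theorem sectionOfEquivariant_surjective [IsManifold I' ∞ M] [ContMDiffSMul I I' ∞ G M]
    [I.Boundaryless] [I'.Boundaryless] [FiniteDimensional ℝ E] [FiniteDimensional ℝ E']
    [SecondCountableTopology G] (o : M) :
    Function.Surjective (sectionOfEquivariant (I := I) (G := G) I' o) := by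
  rintro ⟨X, hX⟩
  have hex : ∀ g : G, ∃ v : GroupLieAlgebra I G, AtiyahFiber.mk g rfl v = X (g • o) := fun g =>
    (AtiyahFiber.mk_bijective g rfl).2 _
  choose x hx' using hex
  have hx : ∀ (g : G) (u : M) (hu : g • o = u), AtiyahFiber.mk g hu (x g) = X u := by
    rintro g _ rfl
    exact hx' g
  have heq : ∀ (g k : G), g • o = k • o → x k = Ad (g⁻¹ * k)⁻¹ (x g) := fun g k h =>
    (AtiyahFiber.mk_eq_mk_iff h rfl _ _).1 ((hx g _ h).trans (hx k _ rfl).symm)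
  have hsmooth : ContMDiff I 𝓘(ℝ, E) ∞ (M' := E) x := by
    intro g₀
    obtain ⟨U, σ, hU, hσ⟩ := exists_isCartanGauge I I' G o (g₀ • o)
    obtain ⟨f, hf, hXf⟩ := hX U σ hσ
    have hπ := contMDiff_orbitMap I G I' o
    have hnhds : U ∈ 𝓝 (g₀ • o) := hσ.isOpen.mem_nhds hU
    have hπU : ∀ᶠ g in 𝓝 g₀, g • o ∈ U := hπ.continuous.continuousAt.eventually_mem hnhds
    have h1 : ContMDiffAt I I ∞ (fun g => g⁻¹ * σ (g • o)) g₀ :=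
      contMDiffAt_id.inv.mul
        (ContMDiffAt.comp (I' := I') g₀ (hσ.smooth.contMDiffAt hnhds) hπ.contMDiffAt)
    have h2 : ContMDiffAt I 𝓘(ℝ, E) ∞ (M' := E) (fun g => f (g • o)) g₀ :=
      ContMDiffAt.comp (I' := I') (M'' := E) g₀ (hf.contMDiffAt hnhds) hπ.contMDiffAt
    -- `g` and `σ (g • o)` lie over the same point, so `[(σ (g • o), f (g • o))] = [(g, x g)]`
    -- expresses `x g` by this formula near `g₀`.
    have h3 : ContMDiffAt I 𝓘(ℝ, E) ∞ (M' := E)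
        (fun g => AdCLM I (g⁻¹ * σ (g • o)) (f (g • o))) g₀ :=
      ContMDiffAt.clm_apply (contMDiff_AdCLM.contMDiffAt.comp g₀ h1) h2
    refine h3.congr_of_eventuallyEq ?_
    filter_upwards [hπU] with g hg
    have h4 : AtiyahFiber.mk (σ (g • o)) (hσ.smul_eq _ hg) (f (g • o)) =
        AtiyahFiber.mk g rfl (x g) := by
      rw [← hXf _ _ hg, hx]
    have h5 := (AtiyahFiber.mk_eq_mk_iff _ _ _ _).1 h4
    rw [mul_inv_rev, inv_inv] at h5
    exact h5
  have hxm : x ∈ equivariantFunctions I (MulAction.stabilizer G o) := by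
    refine ⟨hsmooth, fun g h hh => ?_⟩
    rw [heq g (g * h) (by rw [mul_smul, MulAction.mem_stabilizer_iff.1 hh]), inv_mul_cancel_left]
  refine ⟨⟨x, hxm⟩, Subtype.ext (funext fun u => ?_)⟩
  obtain ⟨g, rfl⟩ := MulAction.exists_smul_eq G o u
  rw [sectionOfEquivariant_apply ⟨x, hxm⟩ g _ rfl]
  exact hx g _ rfl

end AtiyahPostLie

end

/-! ### The main theorem: equivariant functions and sections of the Atiyah bundle -/

open AtiyahPostLie in
theorem mainTheorem8
    {E : Type*} [NormedAddCommGroup E] [NormedSpace ℝ E] [FiniteDimensional ℝ E]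
    {B : Type*} [TopologicalSpace B] (I : ModelWithCorners ℝ E B) [I.Boundaryless]
    {G : Type*} [TopologicalSpace G] [ChartedSpace B G] [Group G] [LieGroup I ∞ G]
    [SecondCountableTopology G]
    {E' : Type*} [NormedAddCommGroup E'] [NormedSpace ℝ E'] [FiniteDimensional ℝ E']
    {B' : Type*} [TopologicalSpace B'] (I' : ModelWithCorners ℝ E' B') [I'.Boundaryless]
    {M : Type*} [TopologicalSpace M] [ChartedSpace B' M] [IsManifold I' ∞ M]
    [MulAction G M] [ContMDiffSMul I I' ∞ G M] [MulAction.IsPretransitive G M]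
    (o : M) :
    ∃ (hbr : ∀ x ∈ equivariantFunctions I (MulAction.stabilizer G o),
        ∀ y ∈ equivariantFunctions I (MulAction.stabilizer G o),
          bracket x y ∈ equivariantFunctions I (MulAction.stabilizer G o))
      (htr : ∀ x ∈ equivariantFunctions I (MulAction.stabilizer G o),
        ∀ y ∈ equivariantFunctions I (MulAction.stabilizer G o),
          triangle x y ∈ equivariantFunctions I (MulAction.stabilizer G o)),
      IsPostLie ℝ (A := equivariantFunctions I (MulAction.stabilizer G o))
        (fun x y => ⟨bracket x.1 y.1, hbr x.1 x.2 y.1 y.2⟩)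
        (fun x y => ⟨triangle x.1 y.1, htr x.1 x.2 y.1 y.2⟩) ∧
      ∃ Φ : equivariantFunctions I (MulAction.stabilizer G o) ≃ₗ[ℝ] smoothSections I G I' o,
        (∀ (x : equivariantFunctions I (MulAction.stabilizer G o)) (g : G) (u : M)
          (hu : g • o = u), (Φ x).1 u = AtiyahFiber.mk g hu (x.1 g)) ∧
        IsPostLie ℝ (A := smoothSections I G I' o)
          (fun X Y => Φ ⟨bracket (Φ.symm X).1 (Φ.symm Y).1,
            hbr _ (Φ.symm X).2 _ (Φ.symm Y).2⟩)
          (fun X Y => Φ ⟨triangle (Φ.symm X).1 (Φ.symm Y).1,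
            htr _ (Φ.symm X).2 _ (Φ.symm Y).2⟩) := by
  have : CompleteSpace E := FiniteDimensional.complete ℝ E
  exact ⟨fun x hx y hy => bracket_mem_equivariantFunctions hx hy,
    fun x hx y hy => triangle_mem_equivariantFunctions hx hy,
    isPostLie_equivariantFunctions _,
    LinearEquiv.ofBijective (sectionOfEquivariant I' o)
      ⟨sectionOfEquivariant_injective o, sectionOfEquivariant_surjective o⟩,
    fun x g u hu => sectionOfEquivariant_apply x g u hu,
    (isPostLie_equivariantFunctions _).transport _⟩
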